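/- **Model.** Fix $\mu_0>0$, $K>1$, $\lambda>0$, $\beta>0$ and $f$ with $1/K<f<1$, and put $\mu_{c1}=K\mu_0$, $\mu_{l2}=\mu_0/f$, $\mu_{c2}=K\mu_0/(1-f)$. Jobs arrive to a base queue as a Poisson process of rate $\lambda$. A job of the base queue may be assigned to service mode 1 (SM1: an exponential service of rate $\mu_{c1}$ at the cloud server) or to service mode 2 (SM2: an exponential service of rate $\mu_{l2}$ at the local server, followed by an independent exponential service of rate $\mu_{c2}$ at the cloud server). Each server serves one job at a time and does not idle when it has a job to serve; the cloud gives SM2 jobs preemptive priority over SM1 jobs. The state is $s=(n_0,i_2,i_1,n_2)\in\mathcal S=\mathbb N_0\times\{0,1\}^2\times\mathbb N_0$, where $n_0$ is the number of jobs in the base queue, $i_2$ indicates an SM2 job at the local server, $i_1$ indicates an SM1 job at the cloud (in queue or in service), and $n_2$ is the number of SM2 jobs at the cloud; $n(s)=n_0+i_2+i_1+n_2$. The control actions are $\mathtt{idle}$ (always admissible), $\mathtt{SM1}$ (admissible if $n_0\ge1$ and $i_1=0$; moves the state to $(n_0-1,i_2,1,n_2)$) and $\mathtt{SM2}$ (admissible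 if $n_0\ge1$ and $i_2=0$; moves the state to $(n_0-1,1,i_1,n_2)$). A (stationary Markovian) policy $\pi$ chooses an admissible action $\pi(s)$ in each state $s$. Decisions are taken at time $0$, at arrivals and at service completions, and at such an instant several actions may be taken in immediate succession (the policy is applied until it idles). Let $J_\beta(s_0;\pi)=\mathbb E_\pi\big[\int_0^\infty e^{-\beta t}\,n(s(t))\,dt \mid s(0)=s_0\big]$ and $V_\beta(s_0)=\inf_\pi J_\beta(s_0;\pi)$, the infimum being over all such policies. A policy $\pi^*$ is *delay-optimal* if $J_\beta(s_0;\pi^*)=V_\beta(s_0)$ for all $s_0\in\mathcal S$. A policy $\pi$ is *cloud-first* if $\pi(n_0,i_2,0,0)=\mathtt{SM1}$ for all $n_0\ge1$ and $i_2\in\{0,1\}$. **Theorem (Partial switch-type structure).** Let $\pi^*$ be a delay-optimal, cloud-first policy. Then there exist non-increasing sequences of non-negative integers $(N_k)_{k\ge0}$ and $(N'_k)_{k\ge1}$ such that, for all $x_0,x_2\in\mathbb N_0$, $$\pi^*(N_k+x_0,\,0,\,1,\,k+x_2)=\mathtt{SM2}\quad\text{for all }k\ge0,$$ $$\pi^*(N'_k+x_0,\,0,\,0,\,k+x_2)=\mathtt{SM2}\quad\text{for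 all }k\ge1.$$ -/

import Mathlib

open MeasureTheory ProbabilityTheory
open scoped ENNReal

namespace Offload

/-- Parameters of the offloading system: the local server has capacity `μ₀`, the cloud has capacity
`K μ₀` with `K > 1`, a fraction `f` of the work is done locally in service mode 2, jobs arrive at
rate `lam`, and costs are discounted at rate `β`. -/
structure Params where
  μ₀ : ℝ
  K : ℝ
  f : ℝ
  lam : ℝ
  β : ℝ
  μ₀_pos : 0 < μ₀
  one_lt_K : 1 < K
  inv_K_lt_f : 1 / K < f
  f_lt_one : f < 1
  lam_pos : 0 < lam
  β_pos : 0 < β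

namespace Params

variable (P : Params)

/-- Service rate at the cloud of a job in service mode 1. -/
noncomputable def μc1 : ℝ := P.K * P.μ₀

/-- Service rate at the local server of a job in service mode 2. -/
noncomputable def μl2 : ℝ := P.μ₀ / P.f

/-- Service rate at the cloud of a job in service mode 2. -/
noncomputable def μc2 : ℝ := P.K * P.μ₀ / (1 - P.f)

end Params

/-- A state `(n₀, i₂, i₁, n₂)`: `n0` jobs in the base queue, `i2` tells whether a mode-2 job is at
the local server, `i1` whether a mode-1 job is at the cloud (in queue or in service), and `n2` is
the number of mode-2 jobs at the cloud. -/
@[ext]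
structure State where
  n0 : ℕ
  i2 : Bool
  i1 : Bool
  n2 : ℕ

namespace State

/-- The total number of jobs in the system. -/
def jobs (s : State) : ℕ := s.n0 + s.i2.toNat + s.i1.toNat + s.n2

/-- Arrival of a job. -/
def arrive (s : State) : State := { s with n0 := s.n0 + 1 }

/-- Departure of the mode-1 job from the cloud. -/
def departOne (s : State) : State := { s with i1 := false }

/-- Departure of a mode-2 job from the cloud. -/
def departTwo (s : State) : State := { s with n2 := s.n2 - 1 }

/-- Completion of the local service of a mode-2 job, which moves on to the cloud. -/
def finishLocal (s : State) : State := { s with i2 := false, n2 := s.n2 + s.i2.toNat }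

/-- Assignment of a job of the base queue to service mode 1. -/
def assignOne (s : State) : State := { s with n0 := s.n0 - 1, i1 := true }

/-- Assignment of a job of the base queue to service mode 2. -/
def assignTwo (s : State) : State := { s with n0 := s.n0 - 1, i2 := true }

end State

/-- The control actions. -/
inductive Action where
  | idle
  | sm1
  | sm2

/-- The action is admissible in the state: `SM1` needs a job in the base queue and no mode-1 job
at the cloud, `SM2` needs a job in the base queue and no job at the local server. -/
def Admissible (s : State) : Action → Prop
  | .idle => True
  | .sm1 => 1 ≤ s.n0 ∧ s.i1 = false
  | .sm2 => 1 ≤ s.n0 ∧ s.i2 = false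

/-- The state immediately after an action. -/
def Action.apply : Action → State → State
  | .idle, s => s
  | .sm1, s => s.assignOne
  | .sm2, s => s.assignTwo

/-- A stationary Markovian policy. -/
structure Policy where
  act : State → Action
  admissible : ∀ s, Admissible s (act s)

/-- The state after all the decisions that the policy takes at one instant, starting from `s`: the
policy is consulted repeatedly, until it idles. No more than two assignments are possible, since
each of them fills one of the two unit buffers (see `Policy.act_settle`). -/
def Policy.settle (π : Policy) (s : State) : State :=
  let s' := (π.act s).apply s
  (π.act s').apply s'

theorem Policy.act_settle (π : Policy) (s : State) : π.act (π.settle s) = .idle := by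
  have h0 := π.admissible s
  unfold Policy.settle
  rcases e0 : π.act s <;> simp only [Action.apply, e0] at h0 ⊢
  · have h1 := π.admissible s.assignOne
    rcases e1 : π.act s.assignOne <;> simp only [e1] at h1 ⊢
    · simp [Admissible, State.assignOne] at h1
    · have h2 := π.admissible s.assignOne.assignTwo
      rcases e2 : π.act s.assignOne.assignTwo <;> simp only [e2] at h2 ⊢ <;>
        simp [Admissible, State.assignOne, State.assignTwo] at h2
  · have h1 := π.admissible s.assignTwo
    rcases e1 : π.act s.assignTwo <;> simp only [e1] at h1 ⊢
    · have h2 := π.admissible s.assignTwo.assignOne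
      rcases e2 : π.act s.assignTwo.assignOne <;> simp only [e2] at h2 ⊢ <;>
        simp [Admissible, State.assignOne, State.assignTwo] at h2
    · simp [Admissible, State.assignTwo] at h1

/-- The four exponential clocks that drive the system. -/
inductive Clock where
  | arrival
  | localTwo
  | cloudOne
  | cloudTwo

instance : Fintype Clock where
  elems := ⟨Multiset.ofList [.arrival, .localTwo, .cloudOne, .cloudTwo], by simp⟩
  complete c := by cases c <;> simp

instance : MeasurableSpace Clock := ⊤

/-- The effect of a tick of a clock. The cloud serves mode-2 jobs with (preemptive) priority: the
mode-1 job is in service exactly when there is no mode-2 job at the cloud. The tick of a clock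
whose server is not serving a job of the corresponding mode has no effect. -/
def Clock.step : Clock → State → State
  | .arrival, s => s.arrive
  | .localTwo, s => if s.i2 = true then s.finishLocal else s
  | .cloudOne, s => if s.i1 = true ∧ s.n2 = 0 then s.departOne else s
  | .cloudTwo, s => if 1 ≤ s.n2 then s.departTwo else s

namespace Params

variable (P : Params)

/-- The rates of the clocks. -/
noncomputable def rate : Clock → ℝ
  | .arrival => P.lam
  | .localTwo => P.μl2
  | .cloudOne => P.μc1
  | .cloudTwo => P.μc2

/-- The total rate of the four clocks. -/
noncomputable def totalRate : ℝ := ∑ c, P.rate c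

theorem rate_pos (c : Clock) : 0 < P.rate c := by
  have hμ := P.μ₀_pos
  have hK : 0 < P.K := lt_trans one_pos P.one_lt_K
  have hf : 0 < P.f := lt_trans (by positivity) P.inv_K_lt_f
  have hf1 : 0 < 1 - P.f := sub_pos.mpr P.f_lt_one
  cases c
  · exact P.lam_pos
  · exact div_pos hμ hf
  · exact mul_pos hK hμ
  · exact div_pos (mul_pos hK hμ) hf1

theorem totalRate_pos : 0 < P.totalRate :=
  Finset.sum_pos (fun c _ => P.rate_pos c) ⟨Clock.arrival, Finset.mem_univ _⟩

/-- The law of the clock that ticks next: each clock has probability proportional to its rate. -/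
noncomputable def clockLaw : Measure Clock :=
  ∑ c, ENNReal.ofReal (P.rate c / P.totalRate) • Measure.dirac c

instance : IsProbabilityMeasure P.clockLaw := by
  constructor
  simp only [clockLaw, Measure.finsetSum_apply, Measure.smul_apply, measure_univ, smul_eq_mul,
    mul_one]
  rw [← ENNReal.ofReal_sum_of_nonneg
    (fun c _ => div_nonneg (P.rate_pos c).le P.totalRate_pos.le), ← Finset.sum_div]
  change ENNReal.ofReal (P.totalRate / P.totalRate) = 1
  rw [div_self P.totalRate_pos.ne', ENNReal.ofReal_one]

/-- The law of one tick: the time since the previous tick, and the clock that ticks. -/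
noncomputable def tickLaw : Measure (ℝ × Clock) := (expMeasure P.totalRate).prod P.clockLaw

instance : IsProbabilityMeasure P.tickLaw := by
  have := isProbabilityMeasure_expMeasure P.totalRate_pos
  unfold tickLaw
  infer_instance

/-- The law of the sequence of all ticks. The ticks are those of four independent Poisson processes
with the rates of the clocks: the superposition is a Poisson process with the total rate, whose
points carry independent marks. -/
noncomputable def law : Measure (ℕ → ℝ × Clock) := Measure.infinitePi fun _ => P.tickLaw

instance : IsProbabilityMeasure P.law := by
  unfold law
  infer_instance

end Params

/-- The time of the `k`-th tick (with time `0` for `k = 0`). -/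
def tickTime (ω : ℕ → ℝ × Clock) (k : ℕ) : ℝ := ∑ j ∈ Finset.range k, (ω j).1

/-- The number of ticks up to time `t`. -/
noncomputable def tickCount (ω : ℕ → ℝ × Clock) (t : ℝ) : ℕ :=
  {k : ℕ | tickTime ω (k + 1) ≤ t}.ncard

/-- The state after `k` ticks and the decisions taken there, under the policy `π`, from the initial
state `s`. -/
def Policy.chain (π : Policy) (s : State) (ω : ℕ → ℝ × Clock) : ℕ → State
  | 0 => π.settle s
  | k + 1 => π.settle ((ω k).2.step (π.chain s ω k))

/-- The state at time `t`. -/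
noncomputable def Policy.stateAt (π : Policy) (s : State) (ω : ℕ → ℝ × Clock) (t : ℝ) : State :=
  π.chain s ω (tickCount ω t)

/-- The discounted cost-to-go `J_β(s; π)`, the expectation of `∫₀^∞ e^{-β t} n(t) dt`. -/
noncomputable def cost (P : Params) (π : Policy) (s : State) : ℝ≥0∞ :=
  ∫⁻ ω, (∫⁻ t in Set.Ioi (0 : ℝ),
    ENNReal.ofReal (Real.exp (-(P.β * t))) * ((π.stateAt s ω t).jobs : ℝ≥0∞)) ∂P.law

/-- The value function `V_β`. -/
noncomputable def value (P : Params) (s : State) : ℝ≥0∞ := ⨅ π : Policy, cost P π s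

/-- A policy is delay-optimal if its cost-to-go is the value function, from every state. -/
def DelayOptimal (P : Params) (π : Policy) : Prop := ∀ s, cost P π s = value P s

/-- A policy is cloud-first if it assigns `SM1` whenever the base queue is nonempty and there is no
job at the cloud. -/
def CloudFirst (π : Policy) : Prop :=
  ∀ s : State, 1 ≤ s.n0 → s.i1 = false → s.n2 = 0 → π.act s = .sm1

end Offload

namespace Offload

/-! One threshold works for every `k`, so both sequences can be constant. Write `l < c₁ < c₂` for
the local, mode-1 and mode-2 cloud rates, `r` for the sum of all clock rates and `β`, and `v` for
the value function. Conditioning on the first tick turns the cost into a one-step recursion.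
Optimality, tested against policies changed in a single state, then gives the optimality equations
(`DelayOptimal.isOptimalValue`). Afterwards probability disappears: values at two states are
compared through these equations, and `maximum_principle` turns one-step inequalities into global
ones.

Gain. Turning a job that is at the local server, in mode 1 or (with the cloud occupied) in the base
queue into an additional mode-2 job at the cloud, where `k` others are present, lowers `v` by at
least `g * q ^ k` (`gain_of_closed` and its five instances). Once those `k` have left, the cloud
works at rate `c₂` instead of `c₁`, and the surplus rate `c₂ - c₁` removes a job worth at least `1 /
r`. The factor `q = c₂ / (β + l + c₂)` is paid per mode-2 departure.

Loss. Let `D n k` be the excess of `v` after `SM2` over `v` before it, with a mode-1 job at the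
cloud. If idling is chosen, the local completion contributes a gain of order `q ^ k`, while a
positive loss can only stem from the state in which the base queue has run empty and the cloud has
cleared. Reaching it takes `n` mode-1 departures, each discounted by `p = c₁ / (β + l + c₁)`. Hence
`D n k ≤ q ^ k * max 0 (C * p ^ n - c * k)` (`loss_le`). For large `n` the gain wins, uniformly in
`k`, and idling contradicts `0 ≤ D n k`.

Without a mode-1 job the same argument excludes idling when `1 ≤ n₂`. It remains to exclude `SM1`
(`exists_sm1_lt`): it is strictly worse for many mode-2 jobs at the cloud, and this strictness is
carried to all positive `n₂` at the price of a longer base queue. -/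

instance : MeasurableSpace State := ⊤

instance : Countable State :=
  Function.Injective.countable (f := fun s : State => (s.n0, s.i2, s.i1, s.n2)) (by
    rintro ⟨a, b, c, d⟩ ⟨a', b', c', d'⟩ h
    simpa using h)

/-! ### The sequence of ticks -/

/-- The sequence of ticks with first tick `p` and remaining ticks `ω`. -/
def consTick (p : ℝ × Clock) (ω : ℕ → ℝ × Clock) : ℕ → ℝ × Clock
  | 0 => p
  | n + 1 => ω n

theorem measurable_consTick :
    Measurable fun q : (ℝ × Clock) × (ℕ → ℝ × Clock) => consTick q.1 q.2 := by
  refine measurable_pi_lambda _ fun n => ?_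
  cases n with
  | zero => exact measurable_fst
  | succ n => exact (measurable_pi_apply n).comp measurable_snd

/-- Prepending an independent tick preserves the product law: both measures agree on cylinders,
where coordinate `0` splits off and the others shift by one. -/
theorem law_eq_map (P : Params) :
    P.law = (P.tickLaw.prod P.law).map fun q => consTick q.1 q.2 := by
  symm
  refine Measure.eq_infinitePi _ fun s t ht => ?_
  rw [Measure.map_apply measurable_consTick
    (MeasurableSet.pi (Finset.countable_toSet s) fun i _ => ht i)]
  let u : Finset ℕ := s.preimage Nat.succ Nat.succ_injective.injOn
  have hset : (fun q : (ℝ × Clock) × (ℕ → ℝ × Clock) => consTick q.1 q.2) ⁻¹' Set.pi s t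
      = (if 0 ∈ s then t 0 else Set.univ) ×ˢ Set.pi u fun n => t (n + 1) := by
    ext ⟨p, ω⟩
    simp only [Set.mem_preimage, Set.mem_pi, Set.mem_prod, u, Finset.coe_preimage,
      Finset.mem_coe, Nat.succ_eq_add_one]
    constructor
    · intro h
      refine ⟨?_, fun n hn => h (n + 1) hn⟩
      split_ifs with h0
      · exact h 0 h0
      · trivial
    · rintro ⟨h1, h2⟩ n hn
      cases n with
      | zero => rw [if_pos hn] at h1; exact h1
      | succ n => exact h2 n hn
  rw [hset, Measure.prod_prod, Params.law, Measure.infinitePi_pi _ fun i _ => ht _]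
  have hu : ∏ n ∈ u, P.tickLaw (t (n + 1)) = ∏ n ∈ s.erase 0, P.tickLaw (t n) := by
    refine Finset.prod_bij (fun n _ => n + 1) (by simp [u]) (by simp) ?_ (by simp)
    intro b hb
    rw [Finset.mem_erase] at hb
    obtain ⟨n, rfl⟩ := Nat.exists_eq_succ_of_ne_zero hb.1
    exact ⟨n, by simpa [u] using hb.2, rfl⟩
  rw [hu]
  split_ifs with h0
  · rw [Finset.mul_prod_erase s (fun n => P.tickLaw (t n)) h0]
  · rw [measure_univ, one_mul, Finset.erase_eq_of_notMem h0]

theorem lintegral_clockLaw (P : Params) (g : Clock → ℝ≥0∞) :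
    ∫⁻ c, g c ∂P.clockLaw = ∑ c, ENNReal.ofReal (P.rate c / P.totalRate) * g c := by
  simp only [Params.clockLaw, lintegral_finsetSum_measure, lintegral_smul_measure, smul_eq_mul]
  refine Finset.sum_congr rfl fun c _ => ?_
  rw [lintegral_dirac' _ measurable_from_top]

theorem lintegral_law_cons (P : Params) {G : (ℕ → ℝ × Clock) → ℝ≥0∞} (hG : Measurable G) :
    ∫⁻ ω, G ω ∂P.law = ∫⁻ τ, ∑ c, ENNReal.ofReal (P.rate c / P.totalRate) *
      ∫⁻ ω, G (consTick (τ, c) ω) ∂P.law ∂expMeasure P.totalRate := by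
  have := isProbabilityMeasure_expMeasure P.totalRate_pos
  have hG' : Measurable fun q : (ℝ × Clock) × (ℕ → ℝ × Clock) => G (consTick q.1 q.2) :=
    hG.comp measurable_consTick
  calc ∫⁻ ω, G ω ∂P.law
      = ∫⁻ q, G (consTick q.1 q.2) ∂P.tickLaw.prod P.law := by
        conv_lhs => rw [law_eq_map]
        exact lintegral_map hG measurable_consTick
    _ = ∫⁻ p, ∫⁻ ω, G (consTick p ω) ∂P.law ∂P.tickLaw := lintegral_prod _ hG'.aemeasurable
    _ = _ := by
        rw [Params.tickLaw, lintegral_prod _ hG'.lintegral_prod_right'.aemeasurable]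
        simp_rw [lintegral_clockLaw]

/-! ### Exponential interarrival times -/

theorem lintegral_expMeasure_exp_neg {a b : ℝ} (ha : 0 < a) (hb : 0 < b) :
    ∫⁻ x, ENNReal.ofReal (Real.exp (-(b * x))) ∂expMeasure a = ENNReal.ofReal (a / (a + b)) := by
  have h0 : expMeasure a = volume.withDensity (exponentialPDF a) := rfl
  have hm : Measurable (exponentialPDF a) := (measurable_exponentialPDFReal a).ennreal_ofReal
  rw [h0, lintegral_withDensity_eq_lintegral_mul _ hm (by fun_prop)]
  have h : ∀ x, (exponentialPDF a * fun x => ENNReal.ofReal (Real.exp (-(b * x)))) x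
      = ENNReal.ofReal (a / (a + b)) * exponentialPDF (a + b) x := by
    intro x
    simp only [Pi.mul_apply, exponentialPDF_eq]
    split_ifs
    · rw [← ENNReal.ofReal_mul (by positivity), ← ENNReal.ofReal_mul (by positivity), mul_assoc,
        ← Real.exp_add, ← mul_assoc, div_mul_cancel₀ _ (by positivity)]
      ring_nf
    · simp
  simp_rw [h]
  rw [lintegral_const_mul _ (show Measurable (exponentialPDF (a + b)) from
      (measurable_exponentialPDFReal _).ennreal_ofReal),
    lintegral_exponentialPDF_eq_one (by positivity), mul_one]

theorem ae_expMeasure_nonneg (a : ℝ) : ∀ᵐ x ∂expMeasure a, 0 ≤ x := by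
  have h0 : expMeasure a = volume.withDensity (exponentialPDF a) := rfl
  rw [h0, ae_withDensity_iff (show Measurable (exponentialPDF a) from
    (measurable_exponentialPDFReal a).ennreal_ofReal)]
  refine Filter.Eventually.of_forall fun x hx => ?_
  by_contra h
  exact hx (exponentialPDF_of_neg (not_le.mp h))

/-- The discount accumulated over a time span of length `x`. -/
noncomputable def spanWeight (b x : ℝ) : ℝ≥0∞ := ENNReal.ofReal ((1 - Real.exp (-(b * x))) / b)

theorem measurable_spanWeight (b : ℝ) : Measurable (spanWeight b) := by
  unfold spanWeight
  fun_prop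

theorem lintegral_expMeasure_spanWeight {a b : ℝ} (ha : 0 < a) (hb : 0 < b) :
    ∫⁻ x, spanWeight b x ∂expMeasure a = ENNReal.ofReal (1 / (a + b)) := by
  have := isProbabilityMeasure_expMeasure ha
  -- The two discounts add up to the constant `1 / b` almost surely, so the integral follows from
  -- that of the exponential by cancelling a finite term.
  have h1 : ∫⁻ x, (spanWeight b x + ENNReal.ofReal (1 / b) * ENNReal.ofReal (Real.exp (-(b * x))))
      ∂expMeasure a = ENNReal.ofReal (1 / b) := by
    rw [lintegral_congr_ae (g := fun _ => ENNReal.ofReal (1 / b)), lintegral_const, measure_univ,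
      mul_one]
    filter_upwards [ae_expMeasure_nonneg a] with x hx
    have : Real.exp (-(b * x)) ≤ 1 := Real.exp_le_one_iff.mpr (by nlinarith)
    rw [spanWeight, ← ENNReal.ofReal_mul (by positivity), ← ENNReal.ofReal_add
      (div_nonneg (by linarith) hb.le) (by positivity)]
    congr 1
    field_simp
    ring
  rw [lintegral_add_left (measurable_spanWeight b), lintegral_const_mul _ (by fun_prop),
    lintegral_expMeasure_exp_neg ha hb, ← ENNReal.ofReal_mul (by positivity)] at h1
  have h2 : ENNReal.ofReal (1 / b)
      = ENNReal.ofReal (1 / (a + b)) + ENNReal.ofReal (1 / b * (a / (a + b))) := by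
    rw [← ENNReal.ofReal_add (by positivity) (by positivity)]
    congr 1
    field_simp
    ring
  rw [h2] at h1
  exact (ENNReal.add_left_inj ENNReal.ofReal_ne_top).mp h1

theorem lintegral_Ico_exp_neg {a b c : ℝ} (hc : 0 < c) (hab : a ≤ b) :
    ∫⁻ t in Set.Ico a b, ENNReal.ofReal (Real.exp (-(c * t)))
      = ENNReal.ofReal (Real.exp (-(c * a))) * spanWeight c (b - a) := by
  rw [← ofReal_integral_eq_lintegral_ofReal, integral_Ico_eq_integral_Ioc,
    ← intervalIntegral.integral_of_le hab, spanWeight, ← ENNReal.ofReal_mul (by positivity)]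
  · congr 1
    have : ∀ x ∈ Set.uIcc a b, HasDerivAt (fun t => -(Real.exp (-(c * t)) / c))
        (Real.exp (-(c * x))) x := by
      intro x _
      have h := (((hasDerivAt_id x).const_mul c).neg.exp.div_const c).neg
      refine h.congr_deriv ?_
      simp only [Pi.neg_apply, id]
      field_simp
    rw [intervalIntegral.integral_eq_sub_of_hasDerivAt this
      (Continuous.intervalIntegrable (by fun_prop) _ _)]
    have : Real.exp (-(c * b)) = Real.exp (-(c * a)) * Real.exp (-(c * (b - a))) := by
      rw [← Real.exp_add]; ring_nf
    rw [this]
    ring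
  · exact (Continuous.integrableOn_Icc (by fun_prop)).mono_set Set.Ico_subset_Icc_self
  · exact Filter.Eventually.of_forall fun t => (Real.exp_pos _).le

/-! ### The cost as a discounted sum over the stages -/

theorem tickTime_zero (ω : ℕ → ℝ × Clock) : tickTime ω 0 = 0 := by simp [tickTime]

theorem tickTime_succ (ω : ℕ → ℝ × Clock) (k : ℕ) :
    tickTime ω (k + 1) = tickTime ω k + (ω k).1 := by
  simp [tickTime, Finset.sum_range_succ]

theorem tickTime_consTick (p : ℝ × Clock) (ω : ℕ → ℝ × Clock) (k : ℕ) :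
    tickTime (consTick p ω) (k + 1) = p.1 + tickTime ω k := by
  simp [tickTime, Finset.sum_range_succ', consTick, add_comm]

theorem Policy.chain_consTick (π : Policy) (s : State) (p : ℝ × Clock) (ω : ℕ → ℝ × Clock)
    (k : ℕ) : π.chain s (consTick p ω) (k + 1) = π.chain (p.2.step (π.settle s)) ω k := by
  induction k with
  | zero => rfl
  | succ k ih => rw [Policy.chain, ih]; rfl

theorem measurable_tickTime (k : ℕ) : Measurable fun ω : ℕ → ℝ × Clock => tickTime ω k := by
  unfold tickTime
  fun_prop

theorem Policy.measurable_chain (π : Policy) (s : State) (k : ℕ) :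
    Measurable fun ω => π.chain s ω k := by
  induction k with
  | zero => exact measurable_const
  | succ k ih =>
    have h : Measurable fun q : Clock × State => π.settle (q.1.step q.2) := measurable_of_countable _
    exact h.comp ((measurable_snd.comp (measurable_pi_apply k)).prodMk ih)

/-- The contribution to the discounted cost of the time between tick `k` and tick `k + 1`. -/
noncomputable def stageWeight (b : ℝ) (π : Policy) (s : State) (k : ℕ) (ω : ℕ → ℝ × Clock) :
    ℝ≥0∞ :=
  ENNReal.ofReal (Real.exp (-(b * tickTime ω k))) * spanWeight b (ω k).1 *
    ((π.chain s ω k).jobs : ℝ≥0∞)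

theorem measurable_stageWeight (b : ℝ) (π : Policy) (s : State) (k : ℕ) :
    Measurable (stageWeight b π s k) := by
  have h1 := measurable_tickTime k
  have h2 : Measurable fun ω : ℕ → ℝ × Clock => spanWeight b (ω k).1 :=
    (measurable_spanWeight b).comp (measurable_fst.comp (measurable_pi_apply k))
  have h3 : Measurable fun ω => ((π.chain s ω k).jobs : ℝ≥0∞) :=
    (measurable_of_countable fun x : State => (x.jobs : ℝ≥0∞)).comp (π.measurable_chain s k)
  unfold stageWeight
  fun_prop

theorem stageWeight_consTick (b : ℝ) (π : Policy) (s : State) (k : ℕ) (p : ℝ × Clock)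
    (ω : ℕ → ℝ × Clock) :
    stageWeight b π s (k + 1) (consTick p ω) = ENNReal.ofReal (Real.exp (-(b * p.1))) *
      stageWeight b π (p.2.step (π.settle s)) k ω := by
  simp only [stageWeight, tickTime_consTick, Policy.chain_consTick, consTick]
  rw [mul_add, neg_add, Real.exp_add, ENNReal.ofReal_mul (Real.exp_pos _).le]
  ring

variable (P : Params)

theorem sum_rate_div_totalRate : ∑ c, ENNReal.ofReal (P.rate c / P.totalRate) = 1 := by
  simpa using (lintegral_clockLaw P fun _ => 1).symm

theorem lintegral_stageWeight_zero (π : Policy) (s : State) :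
    ∫⁻ ω, stageWeight P.β π s 0 ω ∂P.law
      = ENNReal.ofReal (1 / (P.totalRate + P.β)) * ((π.settle s).jobs : ℝ≥0∞) := by
  rw [lintegral_law_cons P (measurable_stageWeight _ _ _ _)]
  have h : ∀ (τ : ℝ) (c : Clock) (ω : ℕ → ℝ × Clock), stageWeight P.β π s 0 (consTick (τ, c) ω)
      = spanWeight P.β τ * ((π.settle s).jobs : ℝ≥0∞) := by
    intro τ c ω
    simp [stageWeight, tickTime_zero, Policy.chain, consTick]
  simp_rw [h, lintegral_const, measure_univ, mul_one, ← Finset.sum_mul, sum_rate_div_totalRate,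
    one_mul]
  rw [lintegral_mul_const _ (measurable_spanWeight _),
    lintegral_expMeasure_spanWeight P.totalRate_pos P.β_pos]

theorem lintegral_stageWeight_succ (π : Policy) (s : State) (k : ℕ) :
    ∫⁻ ω, stageWeight P.β π s (k + 1) ω ∂P.law
      = ∑ c, ENNReal.ofReal (P.rate c / (P.totalRate + P.β)) *
        ∫⁻ ω, stageWeight P.β π (c.step (π.settle s)) k ω ∂P.law := by
  rw [lintegral_law_cons P (measurable_stageWeight _ _ _ _)]
  simp_rw [stageWeight_consTick, lintegral_const_mul _ (measurable_stageWeight _ _ _ _)]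
  rw [lintegral_finsetSum _ fun c _ => by fun_prop]
  refine Finset.sum_congr rfl fun c _ => ?_
  simp_rw [← mul_assoc]
  rw [lintegral_mul_const _ (by fun_prop), lintegral_const_mul _ (by fun_prop),
    lintegral_expMeasure_exp_neg P.totalRate_pos P.β_pos, ← ENNReal.ofReal_mul
    (div_nonneg (P.rate_pos c).le P.totalRate_pos.le), div_mul_div_cancel₀ P.totalRate_pos.ne']

theorem lintegral_exp_neg_tickTime (k : ℕ) :
    ∫⁻ ω, ENNReal.ofReal (Real.exp (-(P.β * tickTime ω k))) ∂P.law
      = ENNReal.ofReal (P.totalRate / (P.totalRate + P.β)) ^ k := by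
  induction k with
  | zero => simp [tickTime_zero]
  | succ k ih =>
    have hm : ∀ k, Measurable fun ω : ℕ → ℝ × Clock =>
        ENNReal.ofReal (Real.exp (-(P.β * tickTime ω k))) := fun k => by
      have := measurable_tickTime k
      fun_prop
    rw [lintegral_law_cons P (hm _)]
    simp_rw [tickTime_consTick, mul_add, neg_add, Real.exp_add,
      ENNReal.ofReal_mul (Real.exp_pos _).le, lintegral_const_mul _ (hm k), ih, ← Finset.sum_mul,
      sum_rate_div_totalRate, one_mul]
    rw [lintegral_mul_const _ (by fun_prop),
      lintegral_expMeasure_exp_neg P.totalRate_pos P.β_pos, pow_succ']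

theorem ae_tick_nonneg : ∀ᵐ ω ∂P.law, ∀ k, 0 ≤ (ω k).1 := by
  have := isProbabilityMeasure_expMeasure P.totalRate_pos
  rw [ae_all_iff]
  intro k
  have h : MeasurePreserving (fun ω : ℕ → ℝ × Clock => (ω k).1) P.law (expMeasure P.totalRate) :=
    measurePreserving_fst.comp (measurePreserving_eval_infinitePi (fun _ => P.tickLaw) k)
  exact h.quasiMeasurePreserving.ae (ae_expMeasure_nonneg _)

/-- The expectations of `exp (-β T_k)` are powers of a number below `1`, so the infimum over `k` has
integral `0`. This rules out explosion, so almost every path is exhausted by its stages. -/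
theorem ae_tickTime_unbounded : ∀ᵐ ω ∂P.law, ∀ t, ∃ k, t < tickTime ω k := by
  have hm : ∀ k, Measurable fun ω : ℕ → ℝ × Clock =>
      ENNReal.ofReal (Real.exp (-(P.β * tickTime ω k))) := fun k => by
    have := measurable_tickTime k
    fun_prop
  have hlt : ENNReal.ofReal (P.totalRate / (P.totalRate + P.β)) < 1 := by
    have := P.totalRate_pos
    have := P.β_pos
    rw [ENNReal.ofReal_lt_one, div_lt_one (by positivity)]
    linarith
  have h0 : ∫⁻ ω, ⨅ k, ENNReal.ofReal (Real.exp (-(P.β * tickTime ω k))) ∂P.law = 0 := by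
    refine le_antisymm (ge_of_tendsto' (ENNReal.tendsto_pow_atTop_nhds_zero_of_lt_one hlt)
      fun k => ?_) zero_le
    rw [← lintegral_exp_neg_tickTime P k]
    exact lintegral_mono fun ω => iInf_le _ k
  rw [lintegral_eq_zero_iff (Measurable.iInf hm)] at h0
  filter_upwards [h0] with ω hω t
  have h1 : (⨅ k, ENNReal.ofReal (Real.exp (-(P.β * tickTime ω k))))
      < ENNReal.ofReal (Real.exp (-(P.β * t))) := by
    rw [hω]
    simpa using Real.exp_pos _
  obtain ⟨k, hk⟩ := iInf_lt_iff.mp h1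
  rw [ENNReal.ofReal_lt_ofReal_iff (Real.exp_pos _), Real.exp_lt_exp, neg_lt_neg_iff] at hk
  exact ⟨k, lt_of_mul_lt_mul_left hk P.β_pos.le⟩

theorem monotone_tickTime {ω : ℕ → ℝ × Clock} (h : ∀ k, 0 ≤ (ω k).1) : Monotone (tickTime ω) :=
  monotone_nat_of_le_succ fun k => by rw [tickTime_succ]; linarith [h k]

theorem tickCount_eq {ω : ℕ → ℝ × Clock} (h : ∀ k, 0 ≤ (ω k).1) {k : ℕ} {t : ℝ}
    (ht : t ∈ Set.Ico (tickTime ω k) (tickTime ω (k + 1))) : tickCount ω t = k := by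
  have : {j : ℕ | tickTime ω (j + 1) ≤ t} = Set.Iio k := by
    ext j
    simp only [Set.mem_ofPred_eq, Set.mem_Iio]
    constructor
    · intro hj
      by_contra hjk
      exact absurd (ht.2.trans_le (monotone_tickTime h (by omega : k + 1 ≤ j + 1))) (not_lt.mpr hj)
    · intro hj
      exact (monotone_tickTime h (by omega : j + 1 ≤ k)).trans ht.1
  rw [tickCount, this, Set.ncard_Iio_nat]

theorem lintegral_path_eq_tsum {ω : ℕ → ℝ × Clock} (h : ∀ k, 0 ≤ (ω k).1)
    (hu : ∀ t, ∃ k, t < tickTime ω k) (π : Policy) (s : State) :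
    ∫⁻ t in Set.Ioi (0 : ℝ), ENNReal.ofReal (Real.exp (-(P.β * t))) *
      ((π.stateAt s ω t).jobs : ℝ≥0∞) = ∑' k, stageWeight P.β π s k ω := by
  have hU : Set.Ici (0 : ℝ) = ⋃ k, Set.Ico (tickTime ω k) (tickTime ω (k + 1)) := by
    ext t
    simp only [Set.mem_iUnion, Set.mem_Ici]
    constructor
    · intro ht
      have hs := Nat.find_spec (hu t)
      obtain ⟨m, hm⟩ : ∃ m, Nat.find (hu t) = m + 1 := by
        refine Nat.exists_eq_succ_of_ne_zero fun h0 => ?_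
        rw [h0, tickTime_zero] at hs
        linarith
      refine ⟨m, not_lt.mp (Nat.find_min (hu t) (by omega)), ?_⟩
      rwa [hm] at hs
    · rintro ⟨k, hk, _⟩
      have := monotone_tickTime h (Nat.zero_le k)
      rw [tickTime_zero] at this
      linarith
  have hd : Pairwise (Function.onFun Disjoint
      fun k => Set.Ico (tickTime ω k) (tickTime ω (k + 1))) :=
    (monotone_tickTime h).pairwise_disjoint_on_Ico_succ
  -- The half-open stages tile the closed half-line, which differs from the domain of integration by
  -- a null set.
  rw [Measure.restrict_congr_set Ioi_ae_eq_Ici, hU, lintegral_iUnion (fun _ => measurableSet_Ico) hd]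
  refine tsum_congr fun k => ?_
  rw [setLIntegral_congr_fun (g := fun t => ENNReal.ofReal (Real.exp (-(P.β * t))) *
    ((π.chain s ω k).jobs : ℝ≥0∞)) measurableSet_Ico, lintegral_mul_const _ (by fun_prop),
    lintegral_Ico_exp_neg P.β_pos (monotone_tickTime h k.le_succ), stageWeight]
  · rw [tickTime_succ, add_sub_cancel_left]
  · intro t ht
    simp only [Policy.stateAt, tickCount_eq h ht]

theorem cost_eq_tsum (π : Policy) (s : State) :
    cost P π s = ∑' k, ∫⁻ ω, stageWeight P.β π s k ω ∂P.law := by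
  rw [← lintegral_tsum fun k => (measurable_stageWeight _ _ _ _).aemeasurable, cost]
  refine lintegral_congr_ae ?_
  filter_upwards [ae_tick_nonneg P, ae_tickTime_unbounded P] with ω h1 h2
  exact lintegral_path_eq_tsum P h1 h2 π s

/-! ### The one-step operator and its supersolutions -/

/-- The cost until the next tick plus the discounted value `W` after it, for the state `s`. -/
noncomputable def backup (W : State → ℝ≥0∞) (s : State) : ℝ≥0∞ :=
  ENNReal.ofReal (1 / (P.totalRate + P.β)) * (s.jobs : ℝ≥0∞) +
    ∑ c : Clock, ENNReal.ofReal (P.rate c / (P.totalRate + P.β)) * W (c.step s)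

theorem cost_eq_backup (π : Policy) (s : State) :
    cost P π s = backup P (cost P π) (π.settle s) := by
  rw [cost_eq_tsum, tsum_eq_zero_add' ENNReal.summable, lintegral_stageWeight_zero, backup]
  simp_rw [lintegral_stageWeight_succ, cost_eq_tsum, ← ENNReal.tsum_mul_left]
  rw [Summable.tsum_finsetSum fun _ _ => ENNReal.summable]

/-- A supersolution of the one-step recursion dominates the cost: by induction it dominates each
partial sum over the stages, since dropping the remainder only decreases a nonnegative sum. -/
theorem cost_le_of_backup_le (π : Policy) {W : State → ℝ≥0∞}
    (hW : ∀ s, backup P W (π.settle s) ≤ W s) (s : State) : cost P π s ≤ W s := by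
  rw [cost_eq_tsum]
  refine ENNReal.tsum_le_of_sum_range_le fun n => ?_
  induction n generalizing s with
  | zero => simp
  | succ n ih =>
    refine le_trans ?_ (hW s)
    rw [Finset.sum_range_succ', add_comm, lintegral_stageWeight_zero, backup]
    gcongr
    simp_rw [lintegral_stageWeight_succ]
    rw [Finset.sum_comm]
    gcongr with c
    rw [← Finset.mul_sum]
    gcongr
    exact ih _

/-! ### The optimality equations -/

theorem State.jobs_arrive (s : State) : s.arrive.jobs = s.jobs + 1 := by
  simp only [State.jobs, State.arrive]; omega

theorem Action.jobs_apply {s : State} {a : Action} (h : Admissible s a) :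
    (a.apply s).jobs = s.jobs := by
  obtain ⟨n, i, j, k⟩ := s
  cases a
  · rfl
  · obtain ⟨h1, h2⟩ := h
    simp only at h1 h2
    subst h2
    simp only [Action.apply, State.assignOne, State.jobs, Bool.toNat_true, Bool.toNat_false]
    omega
  · obtain ⟨h1, h2⟩ := h
    simp only at h1 h2
    subst h2
    simp only [Action.apply, State.assignTwo, State.jobs, Bool.toNat_true, Bool.toNat_false]
    omega

theorem Policy.jobs_settle (π : Policy) (s : State) : (π.settle s).jobs = s.jobs := by
  rw [Policy.settle, Action.jobs_apply (π.admissible _), Action.jobs_apply (π.admissible _)]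

theorem Clock.jobs_step_le (c : Clock) (s : State) : (c.step s).jobs ≤ s.jobs + 1 := by
  obtain ⟨n, i, j, k⟩ := s
  cases c <;> cases i <;> cases j <;>
    simp only [Clock.step, State.jobs, State.arrive, State.finishLocal, State.departOne,
      State.departTwo] <;> grind

theorem Clock.jobs_step_le_of_ne {c : Clock} (hc : c ≠ .arrival) (s : State) :
    (c.step s).jobs ≤ s.jobs := by
  obtain ⟨n, i, j, k⟩ := s
  cases c
  · exact absurd rfl hc
  all_goals
    cases i <;> cases j <;>
    simp only [Clock.step, State.jobs, State.finishLocal, State.departOne,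
      State.departTwo] <;> grind

/-! ### Policies changed in a single state -/

theorem Policy.settle_of_idle {π : Policy} {s : State} (h : π.act s = .idle) : π.settle s = s := by
  simp [Policy.settle, h, Action.apply]

theorem Policy.settle_apply (π : Policy) (s : State) :
    π.settle ((π.act s).apply s) = π.settle s := by
  have h := π.act_settle s
  unfold Policy.settle at h ⊢
  simp only at h ⊢
  rw [h]
  rfl

theorem Action.n0_apply_le (a : Action) (s : State) : (a.apply s).n0 ≤ s.n0 := by
  cases a <;> simp [Action.apply, State.assignOne, State.assignTwo]

theorem Action.n0_apply_lt {s : State} {a : Action} (h : Admissible s a) (ha : a ≠ .idle) :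
    (a.apply s).n0 < s.n0 := by
  cases a
  · exact absurd rfl ha
  all_goals
    have := h.1
    simp only [Action.apply, State.assignOne, State.assignTwo]
    omega

open Classical in
/-- The policy `π` with the action in the state `s` replaced by `a`. -/
noncomputable def Policy.update (π : Policy) (s : State) (a : Action) (h : Admissible s a) :
    Policy where
  act := Function.update π.act s a
  admissible u := by
    by_cases hu : u = s
    · subst hu; simpa using h
    · simpa [hu] using π.admissible u

theorem Policy.update_act_self (π : Policy) {s : State} {a : Action} (h : Admissible s a) :
    (π.update s a h).act s = a := by simp [Policy.update]

theorem Policy.update_act_of_ne (π : Policy) {s u : State} {a : Action} (h : Admissible s a)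
    (hu : u ≠ s) : (π.update s a h).act u = π.act u := by simp [Policy.update, hu]

/-- Non-idle actions shrink the base queue, so after `a` the state `s` is never revisited at the
same instant and the modification plays no further role. -/
theorem Policy.update_settle_self (π : Policy) {s : State} {a : Action} (h : Admissible s a)
    (ha : a ≠ .idle) : (π.update s a h).settle s = π.settle (a.apply s) := by
  have hlt := Action.n0_apply_lt h ha
  have h1 := Policy.settle_apply (π.update s a h) s
  rw [update_act_self] at h1
  rw [← h1]
  have e1 : a.apply s ≠ s := fun e => by rw [e] at hlt; omega
  have e2 : (π.act (a.apply s)).apply (a.apply s) ≠ s := fun e => by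
    have := Action.n0_apply_le (π.act (a.apply s)) (a.apply s)
    rw [e] at this
    omega
  unfold Policy.settle
  simp only [update_act_of_ne π h e1, update_act_of_ne π h e2]

/-- The decisions taken from `u` either avoid `s`, or pass through `s` and then end, for each
policy, where they would end from `s`. -/
theorem Policy.update_settle (π : Policy) {s : State} {a : Action} (h : Admissible s a)
    (u : State) : (π.update s a h).settle u = π.settle u ∨
      (π.update s a h).settle u = (π.update s a h).settle s ∧ π.settle u = π.settle s := by
  by_cases hu : u = s
  · subst hu; exact Or.inr ⟨rfl, rfl⟩
  · have h1 := Policy.settle_apply (π.update s a h) u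
    have h2 := Policy.settle_apply π u
    rw [update_act_of_ne π h hu] at h1
    by_cases hv : (π.act u).apply u = s
    · rw [hv] at h1 h2
      exact Or.inr ⟨h1.symm, h2.symm⟩
    · left
      unfold Policy.settle
      simp only [update_act_of_ne π h hu, update_act_of_ne π h hv]

variable (P : Params)

theorem backup_mono {W W' : State → ℝ≥0∞} (h : ∀ s, W s ≤ W' s) (s : State) :
    backup P W s ≤ backup P W' s := by
  unfold backup
  gcongr
  exact h _

variable {P} {π : Policy}

/-- The infimum runs over stationary policies, so a one-time deviation is not itself a competitor;
changing the action permanently in one state is. Were the deviation strictly profitable, the cost of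
`π` would be a supersolution for the changed policy, which would then strictly beat `π` at `s`. -/
theorem value_le_backup_update (hopt : DelayOptimal P π) {s : State} {a : Action}
    (h : Admissible s a) : cost P π s ≤ backup P (cost P π) ((π.update s a h).settle s) := by
  by_contra! hlt
  have hle : ∀ u, cost P (π.update s a h) u ≤ cost P π u := by
    refine cost_le_of_backup_le P _ fun u => ?_
    rcases π.update_settle h u with e | ⟨e1, e2⟩
    · rw [e, ← cost_eq_backup]
    · rw [e1, cost_eq_backup P π u, e2, ← cost_eq_backup]
      exact hlt.le
  have h1 : cost P π s ≤ cost P (π.update s a h) s := by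
    rw [hopt s]
    exact iInf_le _ _
  rw [cost_eq_backup P (π.update s a h)] at h1
  exact absurd (h1.trans (backup_mono P hle _)) (not_le.mpr hlt)

theorem cost_le_backup (hopt : DelayOptimal P π) (s : State) :
    cost P π s ≤ backup P (cost P π) s := by
  have h := value_le_backup_update hopt (s := s) (a := .idle) trivial
  rwa [Policy.settle_of_idle (π.update_act_self (s := s) (a := .idle) trivial)] at h

theorem cost_le_apply (hopt : DelayOptimal P π) {s : State} {a : Action} (h : Admissible s a) :
    cost P π s ≤ cost P π (a.apply s) := by
  by_cases ha : a = .idle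
  · subst ha; exact le_rfl
  · have h1 := value_le_backup_update hopt h
    rwa [Policy.update_settle_self π h ha, ← cost_eq_backup] at h1

theorem cost_act (s : State) : cost P π ((π.act s).apply s) = cost P π s := by
  rw [cost_eq_backup, Policy.settle_apply, ← cost_eq_backup]

theorem cost_eq_backup_of_idle {s : State} (h : π.act s = .idle) :
    cost P π s = backup P (cost P π) s := by
  conv_lhs => rw [cost_eq_backup, Policy.settle_of_idle h]

theorem sum_clock {M : Type*} [AddCommMonoid M] (g : Clock → M) :
    ∑ c, g c = g .arrival + (g .localTwo + (g .cloudOne + g .cloudTwo)) := by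
  simp [Finset.sum, Finset.univ, Fintype.elems]

theorem backup_ofReal (P : Params) {w : State → ℝ} (hw : ∀ s, 0 ≤ w s) (s : State) :
    backup P (fun s => ENNReal.ofReal (w s)) s = ENNReal.ofReal
      ((s.jobs + ∑ c : Clock, P.rate c * w (c.step s)) / (P.totalRate + P.β)) := by
  have hβ := P.β_pos
  have hΛ := P.totalRate_pos
  have hp : ∀ c : Clock, 0 ≤ P.rate c / (P.totalRate + P.β) * w (c.step s) := fun c =>
    mul_nonneg (div_nonneg (P.rate_pos c).le (by positivity)) (hw _)
  have e : (s.jobs + ∑ c : Clock, P.rate c * w (c.step s)) / (P.totalRate + P.β)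
      = 1 / (P.totalRate + P.β) * s.jobs +
        ∑ c : Clock, P.rate c / (P.totalRate + P.β) * w (c.step s) := by
    rw [add_div, Finset.sum_div]
    congr 1
    · ring
    · exact Finset.sum_congr rfl fun c _ => by ring
  rw [e, ENNReal.ofReal_add (by positivity) (Finset.sum_nonneg fun c _ => hp c),
    ENNReal.ofReal_mul (by positivity), ENNReal.ofReal_natCast,
    ENNReal.ofReal_sum_of_nonneg fun c _ => hp c, backup]
  congr 1
  refine Finset.sum_congr rfl fun c _ => ?_
  rw [ENNReal.ofReal_mul (div_nonneg (P.rate_pos c).le (by positivity))]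

/-- The bound is the cost when no job ever leaves: the present jobs cost `jobs / β`, the future
arrivals `lam / β ^ 2`. -/
theorem cost_le_linear (P : Params) (π : Policy) (s : State) :
    cost P π s ≤ ENNReal.ofReal (s.jobs / P.β + P.lam / P.β ^ 2) := by
  have hβ := P.β_pos
  have hΛ := P.totalRate_pos
  have hl := P.lam_pos
  refine cost_le_of_backup_le P π (W := fun s => ENNReal.ofReal (s.jobs / P.β + P.lam / P.β ^ 2))
    (fun s => ?_) s
  rw [backup_ofReal P (w := fun s => s.jobs / P.β + P.lam / P.β ^ 2) (fun s => by positivity)]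
  refine ENNReal.ofReal_le_ofReal ?_
  rw [div_le_iff₀ (by positivity), π.jobs_settle, sum_clock]
  have hΛ' : P.totalRate = P.rate .arrival + (P.rate .localTwo + (P.rate .cloudOne +
    P.rate .cloudTwo)) := sum_clock _
  have h0 : P.rate .arrival * ((Clock.arrival.step (π.settle s)).jobs / P.β + P.lam / P.β ^ 2)
      ≤ P.rate .arrival * ((s.jobs + 1) / P.β + P.lam / P.β ^ 2) := by
    have : ((Clock.arrival.step (π.settle s)).jobs : ℝ) ≤ s.jobs + 1 := by
      rw [← π.jobs_settle s]
      exact_mod_cast Clock.jobs_step_le .arrival (π.settle s)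
    have := (P.rate_pos .arrival).le
    gcongr
  have h1 : ∀ c : Clock, c ≠ .arrival →
      P.rate c * ((c.step (π.settle s)).jobs / P.β + P.lam / P.β ^ 2)
        ≤ P.rate c * (s.jobs / P.β + P.lam / P.β ^ 2) := by
    intro c hc
    have : ((c.step (π.settle s)).jobs : ℝ) ≤ s.jobs := by
      rw [← π.jobs_settle s]
      exact_mod_cast Clock.jobs_step_le_of_ne hc (π.settle s)
    have := (P.rate_pos c).le
    gcongr
  have e : (s.jobs / P.β + P.lam / P.β ^ 2) * (P.totalRate + P.β) = s.jobs +
      (P.rate .arrival * ((s.jobs + 1) / P.β + P.lam / P.β ^ 2) +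
      (P.rate .localTwo * (s.jobs / P.β + P.lam / P.β ^ 2) +
      (P.rate .cloudOne * (s.jobs / P.β + P.lam / P.β ^ 2) +
      P.rate .cloudTwo * (s.jobs / P.β + P.lam / P.β ^ 2)))) := by
    rw [hΛ']
    have : P.rate .arrival = P.lam := rfl
    rw [this]
    field_simp
    ring
  rw [e]
  linarith [h1 .localTwo nofun, h1 .cloudOne nofun, h1 .cloudTwo nofun]

/-! ### The optimality equations for real values -/

/-- A real-valued function on the states that satisfies the optimality equations of the offloading
system with arrival rate `lam`, service rates `l`, `c₁` and `c₂` and discount rate `β`, with `π`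
choosing minimizing actions. -/
structure IsOptimalValue (lam l c₁ c₂ β : ℝ) (π : Policy) (v : State → ℝ) : Prop where
  lam_pos : 0 < lam
  l_pos : 0 < l
  l_lt : l < c₁
  c₁_lt : c₁ < c₂
  β_pos : 0 < β
  nonneg : ∀ s, 0 ≤ v s
  le_linear : ∃ a b : ℝ, 0 ≤ a ∧ 0 ≤ b ∧ ∀ s, v s ≤ a * s.jobs + b
  le_apply : ∀ s a, Admissible s a → v s ≤ v (a.apply s)
  act_eq : ∀ s, v ((π.act s).apply s) = v s
  le_backup : ∀ s, (lam + l + c₁ + c₂ + β) * v s ≤ s.jobs + lam * v s.arrive +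
    l * v (Clock.localTwo.step s) + c₁ * v (Clock.cloudOne.step s) +
    c₂ * v (Clock.cloudTwo.step s)
  idle_eq : ∀ s, π.act s = .idle → (lam + l + c₁ + c₂ + β) * v s = s.jobs + lam * v s.arrive +
    l * v (Clock.localTwo.step s) + c₁ * v (Clock.cloudOne.step s) +
    c₂ * v (Clock.cloudTwo.step s)

theorem DelayOptimal.isOptimalValue (hopt : DelayOptimal P π) :
    IsOptimalValue P.lam P.μl2 P.μc1 P.μc2 P.β π fun s => (cost P π s).toReal := by
  have hβ := P.β_pos
  have hΛ := P.totalRate_pos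
  have hl := P.lam_pos
  have hμ := P.μ₀_pos
  have hK : 0 < P.K := lt_trans one_pos P.one_lt_K
  have hf : 0 < P.f := lt_trans (by positivity) P.inv_K_lt_f
  have hf1 : 0 < 1 - P.f := sub_pos.mpr P.f_lt_one
  have hfin : ∀ s, cost P π s ≠ ⊤ := fun s =>
    ne_top_of_le_ne_top ENNReal.ofReal_ne_top (cost_le_linear P π s)
  have hΛ' : P.totalRate = P.lam + (P.μl2 + (P.μc1 + P.μc2)) := sum_clock P.rate
  have hb : ∀ s, backup P (cost P π) s = ENNReal.ofReal
      ((s.jobs + ∑ c : Clock, P.rate c * (cost P π (c.step s)).toReal) /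
        (P.totalRate + P.β)) := by
    intro s
    rw [← backup_ofReal P (w := fun s => (cost P π s).toReal) fun s => ENNReal.toReal_nonneg]
    congr 1
    ext s
    exact (ENNReal.ofReal_toReal (hfin s)).symm
  have hnn : ∀ s : State, 0 ≤ (s.jobs + ∑ c : Clock, P.rate c * (cost P π (c.step s)).toReal) /
      (P.totalRate + P.β) := fun s =>
    div_nonneg (add_nonneg (Nat.cast_nonneg _) (Finset.sum_nonneg fun c _ =>
      mul_nonneg (P.rate_pos c).le ENNReal.toReal_nonneg)) (by positivity)
  have hs : ∀ s : State, s.jobs + ∑ c : Clock, P.rate c * (cost P π (c.step s)).toReal =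
      s.jobs + P.lam * (cost P π s.arrive).toReal +
        P.μl2 * (cost P π (Clock.localTwo.step s)).toReal +
        P.μc1 * (cost P π (Clock.cloudOne.step s)).toReal +
        P.μc2 * (cost P π (Clock.cloudTwo.step s)).toReal := by
    intro s
    rw [sum_clock]
    simp only [Params.rate, ← add_assoc]
    rfl
  refine ⟨hl, P.rate_pos .localTwo, ?_, ?_, hβ, fun s => ENNReal.toReal_nonneg,
    ⟨1 / P.β, P.lam / P.β ^ 2, by positivity, by positivity, fun s => ?_⟩, fun s a h => ?_,
    fun s => by rw [cost_act], fun s => ?_, fun s h => ?_⟩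
  -- The assumption `1 / K < f` is needed exactly here: it makes the local server slower than mode 1
  -- at the cloud.
  · have := P.inv_K_lt_f
    rw [Params.μl2, Params.μc1, div_lt_iff₀ hf]
    rw [div_lt_iff₀ hK] at this
    nlinarith
  · rw [Params.μc2, Params.μc1, lt_div_iff₀ hf1]
    have : 0 < P.K * P.μ₀ := by positivity
    nlinarith
  · refine ENNReal.toReal_le_of_le_ofReal (by positivity) ((cost_le_linear P π s).trans_eq ?_)
    congr 1
    ring
  · exact (ENNReal.toReal_le_toReal (hfin _) (hfin _)).mpr (cost_le_apply hopt h)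
  · have h := cost_le_backup hopt s
    rw [hb] at h
    have h := ENNReal.toReal_le_of_le_ofReal (hnn s) h
    rw [le_div_iff₀ (by positivity), hs, hΛ'] at h
    linarith
  · have h := cost_eq_backup_of_idle (P := P) h
    rw [hb] at h
    have h := congrArg ENNReal.toReal h
    rw [ENNReal.toReal_ofReal (hnn s), eq_div_iff (by positivity), hs, hΛ'] at h
    linarith

/-! ### Steps in coordinates -/

theorem arrive_mk (n : ℕ) (i j : Bool) (k : ℕ) :
    State.arrive ⟨n, i, j, k⟩ = ⟨n + 1, i, j, k⟩ := rfl

theorem localTwo_true (n : ℕ) (j : Bool) (k : ℕ) :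
    Clock.localTwo.step ⟨n, true, j, k⟩ = ⟨n, false, j, k + 1⟩ := by
  simp [Clock.step, State.finishLocal]

theorem localTwo_false (n : ℕ) (j : Bool) (k : ℕ) :
    Clock.localTwo.step ⟨n, false, j, k⟩ = ⟨n, false, j, k⟩ := by
  simp [Clock.step]

theorem cloudOne_false (n : ℕ) (i : Bool) (k : ℕ) :
    Clock.cloudOne.step ⟨n, i, false, k⟩ = ⟨n, i, false, k⟩ := by
  simp [Clock.step]

theorem cloudOne_true_zero (n : ℕ) (i : Bool) :
    Clock.cloudOne.step ⟨n, i, true, 0⟩ = ⟨n, i, false, 0⟩ := by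
  simp [Clock.step, State.departOne]

theorem cloudOne_succ (n : ℕ) (i j : Bool) (k : ℕ) :
    Clock.cloudOne.step ⟨n, i, j, k + 1⟩ = ⟨n, i, j, k + 1⟩ := by
  simp [Clock.step]

theorem cloudTwo_zero (n : ℕ) (i j : Bool) :
    Clock.cloudTwo.step ⟨n, i, j, 0⟩ = ⟨n, i, j, 0⟩ := by
  simp [Clock.step]

theorem cloudTwo_succ (n : ℕ) (i j : Bool) (k : ℕ) :
    Clock.cloudTwo.step ⟨n, i, j, k + 1⟩ = ⟨n, i, j, k⟩ := by
  simp [Clock.step, State.departTwo]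

theorem Policy.act_zero (π : Policy) (i j : Bool) (k : ℕ) : π.act ⟨0, i, j, k⟩ = .idle := by
  have h := π.admissible ⟨0, i, j, k⟩
  cases e : π.act ⟨0, i, j, k⟩ <;> simp [e, Admissible] at h ⊢

theorem Policy.act_true_true (π : Policy) (n k : ℕ) : π.act ⟨n, true, true, k⟩ = .idle := by
  have h := π.admissible ⟨n, true, true, k⟩
  cases e : π.act ⟨n, true, true, k⟩ <;> simp [e, Admissible] at h ⊢

theorem Policy.act_false_true (π : Policy) (n k : ℕ) :
    π.act ⟨n, false, true, k⟩ = .idle ∨ π.act ⟨n, false, true, k⟩ = .sm2 := by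
  have h := π.admissible ⟨n, false, true, k⟩
  cases e : π.act ⟨n, false, true, k⟩ <;> simp [e, Admissible] at h ⊢

theorem Policy.act_true_false (π : Policy) (n k : ℕ) :
    π.act ⟨n, true, false, k⟩ = .idle ∨ π.act ⟨n, true, false, k⟩ = .sm1 := by
  have h := π.admissible ⟨n, true, false, k⟩
  cases e : π.act ⟨n, true, false, k⟩ <;> simp [e, Admissible] at h ⊢

/-! ### A maximum principle -/

theorem nonpos_of_forall_contraction {ι : Type*} {R : ι → Prop} {d w : ι → ℝ} {κ M₀ : ℝ}
    (hκ0 : 0 ≤ κ) (hκ1 : κ < 1) (hM₀ : 0 ≤ M₀) (h0 : ∀ i, R i → d i ≤ M₀ * w i)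
    (h : ∀ M, 0 ≤ M → (∀ i, R i → d i ≤ M * w i) → ∀ i, R i → d i ≤ κ * M * w i) :
    ∀ i, R i → d i ≤ 0 := by
  have hn : ∀ n : ℕ, ∀ i, R i → d i ≤ κ ^ n * M₀ * w i := by
    intro n
    induction n with
    | zero => simpa using h0
    | succ n ih =>
      intro i hi
      have := h _ (by positivity) ih i hi
      rwa [pow_succ', mul_assoc κ]
  intro i hi
  have ht := ((tendsto_pow_atTop_nhds_zero_of_lt_one hκ0 hκ1).mul_const M₀).mul_const (w i)
  rw [zero_mul, zero_mul] at ht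
  exact ge_of_tendsto' ht fun n => hn n i hi

/-- The partial order on states: `s` arises from `s'` by removing jobs. -/
def State.Sub (s s' : State) : Prop :=
  s.n0 ≤ s'.n0 ∧ s.i2.toNat ≤ s'.i2.toNat ∧ s.i1.toNat ≤ s'.i1.toNat ∧ s.n2 ≤ s'.n2

theorem State.Sub.jobs_le {s s' : State} (h : s.Sub s') : s.jobs ≤ s'.jobs := by
  obtain ⟨h1, h2, h3, h4⟩ := h
  unfold State.jobs
  omega

theorem State.Sub.step {s s' : State} (h : s.Sub s') (c : Clock) : (c.step s).Sub (c.step s') := by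
  obtain ⟨n, i, j, k⟩ := s
  obtain ⟨n', i', j', k'⟩ := s'
  obtain ⟨h1, h2, h3, h4⟩ := h
  simp only at h1 h2 h3 h4
  cases c
  · exact ⟨Nat.succ_le_succ h1, h2, h3, h4⟩
  · cases i <;> cases i' <;>
      simp only [localTwo_true, localTwo_false, Bool.toNat_true, Bool.toNat_false] at h2 ⊢ <;>
      exact ⟨h1, by simp at h2 ⊢, h3, by simp at h2 ⊢; try omega⟩
  · cases j <;> cases j' <;> cases k <;> cases k' <;>
      simp only [cloudOne_true_zero, cloudOne_false, cloudOne_succ, Bool.toNat_true,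
        Bool.toNat_false] at h3 ⊢ <;>
      exact ⟨h1, h2, by simp at h3 h4 ⊢, by simp at h3 h4 ⊢; try omega⟩
  · cases k <;> cases k' <;> simp only [cloudTwo_zero, cloudTwo_succ] <;>
      exact ⟨h1, h2, h3, by simp at h4 ⊢; try omega⟩

/-- The smaller system copies the assignment; if its base queue is empty it idles, and the order
survives because the larger system only fills a buffer. -/
theorem State.Sub.exists_apply {s s' : State} (h : s.Sub s') {a' : Action}
    (ha : Admissible s' a') : ∃ a, Admissible s a ∧ (a.apply s).Sub (a'.apply s') := by
  obtain ⟨n, i, j, k⟩ := s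
  obtain ⟨n', i', j', k'⟩ := s'
  obtain ⟨h1, h2, h3, h4⟩ := h
  cases a'
  · exact ⟨.idle, trivial, h1, h2, h3, h4⟩
  · obtain ⟨hn, hj⟩ := ha
    simp only at h1 h2 h3 h4 hn hj
    subst hj
    by_cases h0 : n = 0
    · subst h0
      exact ⟨.idle, trivial, Nat.zero_le _, h2, Bool.toNat_le _, h4⟩
    · refine ⟨.sm1, ⟨Nat.one_le_iff_ne_zero.mpr h0, by simpa using h3⟩, ?_, h2,
        le_rfl, h4⟩
      simp only [Action.apply, State.assignOne]
      omega
  · obtain ⟨hn, hi⟩ := ha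
    simp only at h1 h2 h3 h4 hn hi
    subst hi
    by_cases h0 : n = 0
    · subst h0
      exact ⟨.idle, trivial, Nat.zero_le _, Bool.toNat_le _, h3, h4⟩
    · refine ⟨.sm2, ⟨Nat.one_le_iff_ne_zero.mpr h0, by simpa using h2⟩, ?_, le_rfl,
        h3, h4⟩
      simp only [Action.apply, State.assignTwo]
      omega

namespace IsOptimalValue

variable {lam l c₁ c₂ β : ℝ} {π : Policy} {v : State → ℝ}
  (hv : IsOptimalValue lam l c₁ c₂ β π v)
include hv

theorem c₁_pos : 0 < c₁ := hv.l_pos.trans hv.l_lt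

theorem c₂_pos : 0 < c₂ := hv.c₁_pos.trans hv.c₁_lt

/-- A subsolution of linear growth for the uniformized dynamics is nonpositive. Arrivals make `N i`
grow, so the contraction is taken in a weighted norm. The function `e` is any current upper bound;
the hypothesis need only improve it by one step. -/
theorem maximum_principle {ι : Type*} {R : ι → Prop} {d : ι → ℝ} {N : ι → ℕ} {a b : ℝ}
    (ha : 0 ≤ a) (hb : 0 ≤ b) (hd : ∀ i, R i → d i ≤ a * N i + b)
    (h : ∀ e : ℕ → ℝ, (∀ n, 0 ≤ e n) → Monotone e → (∀ i, R i → d i ≤ e (N i)) → ∀ i, R i →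
      d i ≤ 0 ∨ (lam + l + c₁ + c₂ + β) * d i ≤ lam * e (N i + 1) + (l + c₁ + c₂) * e (N i)) :
    ∀ i, R i → d i ≤ 0 := by
  have := hv.lam_pos
  have := hv.l_pos
  have := hv.c₁_pos
  have := hv.c₂_pos
  have := hv.β_pos
  have hr : 0 < lam + l + c₁ + c₂ + β := by positivity
  -- The constant `2 * lam / β` in the weight makes an arrival cost at most half of the discount:
  -- `lam ≤ β / 2 * w`.
  refine nonpos_of_forall_contraction (w := fun i => N i + (2 * lam / β + 1))
    (κ := (lam + l + c₁ + c₂ + β / 2) / (lam + l + c₁ + c₂ + β)) (M₀ := a + b) (by positivity)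
    ((div_lt_one hr).mpr (by linarith)) (by positivity) (fun i hi => (hd i hi).trans ?_)
    fun M hM hM' i hi => ?_
  · have h1 : 0 ≤ a * (2 * lam / β + 1) := by positivity
    have h2 : 0 ≤ b * (N i + 2 * lam / β) := by positivity
    linarith
  · have hw : (0 : ℝ) ≤ N i + (2 * lam / β + 1) := by positivity
    rcases h (fun n => M * (n + (2 * lam / β + 1))) (fun n => by positivity)
      (fun n m hnm => by dsimp only; gcongr) hM' i hi with h1 | h1
    · exact h1.trans (by positivity)
    · rw [div_mul_eq_mul_div, div_mul_eq_mul_div, le_div_iff₀ hr, mul_comm]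
      refine h1.trans ?_
      have h2 : β / 2 * (2 * lam / β) = lam := by field_simp
      have h3 : lam ≤ β / 2 * (N i + (2 * lam / β + 1)) := by
        rw [mul_add, mul_add, h2]
        have : 0 ≤ β / 2 * (N i : ℝ) := by positivity
        linarith
      have h4 := mul_le_mul_of_nonneg_left h3 hM
      push_cast
      linarith

/-! ### Monotonicity in the number of jobs -/

theorem settle_eq (s : State) : v (π.settle s) = v s := by
  rw [Policy.settle]
  simp only [hv.act_eq]

theorem exists_sub_settle {s s' : State} (h : s.Sub s') :
    ∃ t, v s ≤ v t ∧ t.jobs = s.jobs ∧ t.Sub (π.settle s') := by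
  obtain ⟨a, ha, h1⟩ := h.exists_apply (π.admissible s')
  obtain ⟨b, hb, h2⟩ := h1.exists_apply (π.admissible _)
  refine ⟨b.apply (a.apply s), (hv.le_apply _ _ ha).trans (hv.le_apply _ _ hb), ?_, h2⟩
  rw [Action.jobs_apply hb, Action.jobs_apply ha]

/-- The smaller system imitates the decisions in the larger one; the order survives every tick, and
the running cost is never higher. -/
theorem le_of_sub {s s' : State} (h : s.Sub s') : v s ≤ v s' := by
  obtain ⟨a, b, ha, hb, hab⟩ := hv.le_linear
  have key := hv.maximum_principle (ι := State × State) (R := fun i => i.1.Sub i.2)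
    (d := fun i => v i.1 - v i.2) (N := fun i => i.2.jobs) ha hb ?_ ?_ (s, s') h
  · linarith
  · rintro ⟨s, s'⟩ h
    have h1 := hab s
    have h2 := hv.nonneg s'
    have h3 : (s.jobs : ℝ) ≤ s'.jobs := by exact_mod_cast h.jobs_le
    have h4 := mul_le_mul_of_nonneg_left h3 ha
    dsimp only
    linarith
  · rintro e he hmono hd ⟨s, s'⟩ h
    right
    obtain ⟨t, h1, h2, h3⟩ := hv.exists_sub_settle h
    have hB := hv.le_backup t
    have hA := hv.idle_eq _ (π.act_settle s')
    have hj : (t.jobs : ℝ) ≤ (π.settle s').jobs := by exact_mod_cast h3.jobs_le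
    have e0 := (hd (Clock.arrival.step t, Clock.arrival.step (π.settle s'))
      (h3.step .arrival)).trans (hmono (Clock.jobs_step_le _ _))
    have e1 := (hd (Clock.localTwo.step t, Clock.localTwo.step (π.settle s'))
      (h3.step .localTwo)).trans
      (hmono (Clock.jobs_step_le_of_ne (by simp) _))
    have e2 := (hd (Clock.cloudOne.step t, Clock.cloudOne.step (π.settle s'))
      (h3.step .cloudOne)).trans
      (hmono (Clock.jobs_step_le_of_ne (by simp) _))
    have e3 := (hd (Clock.cloudTwo.step t, Clock.cloudTwo.step (π.settle s'))
      (h3.step .cloudTwo)).trans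
      (hmono (Clock.jobs_step_le_of_ne (by simp) _))
    rw [π.jobs_settle] at e0 e1 e2 e3
    have e0 := mul_le_mul_of_nonneg_left e0 hv.lam_pos.le
    have e1 := mul_le_mul_of_nonneg_left e1 hv.l_pos.le
    have e2 := mul_le_mul_of_nonneg_left e2 hv.c₁_pos.le
    have e3 := mul_le_mul_of_nonneg_left e3 hv.c₂_pos.le
    have hr : 0 < lam + l + c₁ + c₂ + β := by
      linarith [hv.lam_pos, hv.l_pos, hv.c₁_pos, hv.c₂_pos, hv.β_pos]
    have h5 := mul_le_mul_of_nonneg_left h1 hr.le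
    rw [hv.settle_eq] at hA
    simp only [Clock.step] at *
    linarith

/-- Up to the next tick the larger system pays for at least one more job, which has discounted cost
`1 / r`; afterwards monotonicity suffices. -/
theorem one_le_mul_sub {s s' : State} (h : s.Sub s') (hj : s.jobs < s'.jobs) :
    1 ≤ (lam + l + c₁ + c₂ + β) * (v s' - v s) := by
  obtain ⟨t, h1, h2, h3⟩ := hv.exists_sub_settle h
  have hB := hv.le_backup t
  have hA := hv.idle_eq _ (π.act_settle s')
  have hj : (t.jobs : ℝ) + 1 ≤ (π.settle s').jobs := by
    rw [h2, π.jobs_settle]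
    exact_mod_cast hj
  have e0 := mul_le_mul_of_nonneg_left (hv.le_of_sub (h3.step .arrival)) hv.lam_pos.le
  have e1 := mul_le_mul_of_nonneg_left (hv.le_of_sub (h3.step .localTwo)) hv.l_pos.le
  have e2 := mul_le_mul_of_nonneg_left (hv.le_of_sub (h3.step .cloudOne)) hv.c₁_pos.le
  have e3 := mul_le_mul_of_nonneg_left (hv.le_of_sub (h3.step .cloudTwo)) hv.c₂_pos.le
  have hr : 0 < lam + l + c₁ + c₂ + β := by
    linarith [hv.lam_pos, hv.l_pos, hv.c₁_pos, hv.c₂_pos, hv.β_pos]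
  have h5 := mul_le_mul_of_nonneg_left h1 hr.le
  rw [hv.settle_eq] at hA
  simp only [Clock.step] at *
  linarith

theorem le_sm1 (n : ℕ) (i : Bool) (k : ℕ) : v ⟨n + 1, i, false, k⟩ ≤ v ⟨n, i, true, k⟩ :=
  hv.le_apply ⟨n + 1, i, false, k⟩ .sm1 ⟨Nat.le_add_left 1 n, rfl⟩

theorem le_sm2 (n : ℕ) (j : Bool) (k : ℕ) : v ⟨n + 1, false, j, k⟩ ≤ v ⟨n, true, j, k⟩ :=
  hv.le_apply ⟨n + 1, false, j, k⟩ .sm2 ⟨Nat.le_add_left 1 n, rfl⟩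

theorem eq_sm1 {n : ℕ} {i : Bool} {k : ℕ} (h : π.act ⟨n + 1, i, false, k⟩ = .sm1) :
    v ⟨n + 1, i, false, k⟩ = v ⟨n, i, true, k⟩ := by
  rw [← hv.act_eq ⟨n + 1, i, false, k⟩, h]
  rfl

theorem eq_sm2 {n : ℕ} {j : Bool} {k : ℕ} (h : π.act ⟨n + 1, false, j, k⟩ = .sm2) :
    v ⟨n + 1, false, j, k⟩ = v ⟨n, true, j, k⟩ := by
  rw [← hv.act_eq ⟨n + 1, false, j, k⟩, h]
  rfl

theorem eq_cloudFirst (hcf : CloudFirst π) (n : ℕ) (i : Bool) :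
    v ⟨n + 1, i, false, 0⟩ = v ⟨n, i, true, 0⟩ :=
  hv.eq_sm1 (hcf _ (Nat.le_add_left 1 n) rfl rfl)

/-- A single job is better served at the cloud than in mode 2. -/
theorem single_cloud_le_local (hcf : CloudFirst π) :
    v ⟨0, false, true, 0⟩ ≤ v ⟨0, true, false, 0⟩ := by
  have hB := hv.le_backup ⟨0, false, true, 0⟩
  have hA := hv.idle_eq _ (π.act_zero true false 0)
  simp only [arrive_mk, localTwo_true, localTwo_false, cloudOne_false, cloudOne_true_zero,
    cloudTwo_zero, State.jobs, Bool.toNat_true, Bool.toNat_false] at hA hB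
  have e0 : v ⟨1, false, true, 0⟩ ≤ v ⟨1, true, false, 0⟩ :=
    (hv.le_sm2 0 true 0).trans_eq (hv.eq_cloudFirst hcf 0 true).symm
  have e1 : v ⟨0, false, false, 0⟩ ≤ v ⟨0, false, false, 1⟩ :=
    hv.le_of_sub ⟨le_rfl, le_rfl, le_rfl, Nat.zero_le _⟩
  have e2 : v ⟨0, false, false, 0⟩ ≤ v ⟨0, true, false, 0⟩ :=
    hv.le_of_sub ⟨le_rfl, Nat.zero_le _, le_rfl, le_rfl⟩
  have e0 := mul_le_mul_of_nonneg_left e0 hv.lam_pos.le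
  have e1 := mul_le_mul_of_nonneg_left e1 hv.l_pos.le
  have e2 := mul_le_mul_of_nonneg_left e2 (sub_pos.mpr hv.l_lt).le
  have hs : 0 < lam + c₁ + β := by linarith [hv.lam_pos, hv.c₁_pos, hv.β_pos]
  push_cast at hA hB
  refine le_of_mul_le_mul_left ?_ hs
  linarith

end IsOptimalValue

/-! ### The gain from having completed a local service -/

/-- One step of the comparison of a state `B` with an idling state `A`: the successors are again
comparable, where the index drops at the departure of a mode-2 job, and, at index `0`, the mode-1
service in `A` is compared with the faster mode-2 service in `B`. -/
structure ComparisonStep (π : Policy) (v : State → ℝ) (Q : ℕ → State → State → Prop) (k : ℕ)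
    (B A : State) : Prop where
  idle : π.act A = .idle
  arrive : Q k B.arrive A.arrive
  localTwo : v (Clock.localTwo.step B) ≤ v (Clock.localTwo.step A) ∨
    ∃ m, Q m (Clock.localTwo.step B) (Clock.localTwo.step A)
  cloud : (∃ m, k = m + 1 ∧ Q k (Clock.cloudOne.step B) (Clock.cloudOne.step A) ∧
      Q m (Clock.cloudTwo.step B) (Clock.cloudTwo.step A)) ∨
    (k = 0 ∧ Clock.cloudOne.step B = B ∧ Clock.cloudTwo.step A = A ∧ Q 0 B A ∧
      v (Clock.cloudTwo.step B) ≤ v (Clock.cloudOne.step A) ∧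
      (Clock.cloudTwo.step B).Sub A ∧ (Clock.cloudTwo.step B).jobs < A.jobs)

namespace IsOptimalValue

variable {lam l c₁ c₂ β : ℝ} {π : Policy} {v : State → ℝ}
  (hv : IsOptimalValue lam l c₁ c₂ β π v) {g q : ℝ}

include hv in
-- This is the common induction behind all gain estimates. `A` is first moved along an optimal
-- action without changing `v`, and `B` by an admissible move that can only raise `v`. A local
-- completion need only leave a nonnegative difference, so `l` joins `β` as a killing rate in `q`.
theorem gain_of_closed (hq0 : 0 < q) (hq : q * (β + l + c₂) = c₂) (hg0 : 0 < g)
    (hg : (lam + l + c₁ + c₂ + β) * (g * (β + l + c₂)) = c₂ - c₁)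
    {R : ℕ → State → State → Prop} (hj : ∀ k B A, R k B A → B.jobs = A.jobs)
    (h : ∀ k B A, R k B A → g * q ^ k ≤ v A - v B ∨ ∃ B' A', v B ≤ v B' ∧ v A' = v A ∧
      B'.jobs = B.jobs ∧ A'.jobs = A.jobs ∧
      ComparisonStep π v (fun k B A => R k B A ∨ g * q ^ k ≤ v A - v B) k B' A')
    {k : ℕ} {B A : State} (hR : R k B A) : g * q ^ k ≤ v A - v B := by
  have hlam := hv.lam_pos
  have hl := hv.l_pos
  have hc₁ := hv.c₁_pos
  have hc₂ := hv.c₂_pos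
  have hβ := hv.β_pos
  have hr : 0 < lam + l + c₁ + c₂ + β := by positivity
  have hq1 : q ≤ 1 := by
    by_contra hlt
    have : (β + l + c₂) * 1 < (β + l + c₂) * q :=
      mul_lt_mul_of_pos_left (not_le.mp hlt) (by positivity)
    linarith
  obtain ⟨a, b, ha, hb, hab⟩ := hv.le_linear
  have key := hv.maximum_principle (ι := ℕ × State × State) (R := fun i => R i.1 i.2.1 i.2.2)
    (d := fun i => g * q ^ i.1 - (v i.2.2 - v i.2.1)) (N := fun i => i.2.2.jobs) (a := a)
    (b := g + b) ha (by positivity) ?_ ?_ (k, B, A) hR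
  · dsimp only at key
    linarith
  · rintro ⟨k, B, A⟩ hR
    have h1 := hab B
    have h2 := hv.nonneg A
    have h3 : g * q ^ k ≤ g * 1 := mul_le_mul_of_nonneg_left (pow_le_one₀ hq0.le hq1) hg0.le
    dsimp only at hR ⊢
    rw [hj _ _ _ hR] at h1
    linarith
  · rintro e he hmono hd ⟨k, B, A⟩ hR
    have hd' : ∀ k B A, (R k B A ∨ g * q ^ k ≤ v A - v B) →
        g * q ^ k - e A.jobs ≤ v A - v B := by
      rintro k B A (h | h)
      · have := hd (k, B, A) h
        dsimp only at this
        linarith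
      · linarith [he A.jobs]
    rcases h k B A hR with h | ⟨B', A', hB, hA, hjB, hjA, hs⟩
    · left
      dsimp only
      linarith
    right
    dsimp only
    have eB := hv.le_backup B'
    have eA := hv.idle_eq A' hs.idle
    have hjs : (B'.jobs : ℝ) = A'.jobs := by
      rw [hjB, hj _ _ _ hR, hjA]
    have h0 := hd' _ _ _ hs.arrive
    rw [State.jobs_arrive, hjA] at h0
    have h1 : -e A.jobs ≤ v (Clock.localTwo.step A') - v (Clock.localTwo.step B') := by
      rcases hs.localTwo with h | ⟨m, h⟩
      · linarith [he A.jobs]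
      · have h1 := hd' _ _ _ h
        have h2 := hmono (Clock.jobs_step_le_of_ne (c := .localTwo) (by simp) A')
        have h3 : 0 < g * q ^ m := by positivity
        rw [hjA] at h2
        linarith
    have h0 := mul_le_mul_of_nonneg_left h0 hlam.le
    have h1 := mul_le_mul_of_nonneg_left h1 hl.le
    have h5 := mul_le_mul_of_nonneg_left hB hr.le
    rcases hs.cloud with ⟨m, rfl, h2, h3⟩ | ⟨rfl, eB1, eA2, h2, h3, h4, h4'⟩
    · have h2 := hd' _ _ _ h2
      have h3 := hd' _ _ _ h3
      have h2' := hmono (Clock.jobs_step_le_of_ne (c := .cloudOne) (by simp) A')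
      have h3' := hmono (Clock.jobs_step_le_of_ne (c := .cloudTwo) (by simp) A')
      rw [hjA] at h2' h3'
      have h2 := mul_le_mul_of_nonneg_left ((sub_le_sub_left h2' _).trans h2) hc₁.le
      have h3 := mul_le_mul_of_nonneg_left ((sub_le_sub_left h3' _).trans h3) hc₂.le
      -- The choice of `q`: one mode-2 departure, discounted at rate `β + l`, moves the bound from
      -- index `m + 1` to `m`.
      have h6 : c₂ * (g * q ^ m) = (β + l + c₂) * (g * q ^ (m + 1)) := by
        rw [pow_succ]
        linear_combination (-g * q ^ m) * hq
      rw [hA] at eA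
      linarith
    · have h2 := hd' _ _ _ h2
      rw [hjA] at h2
      have h2 := mul_le_mul_of_nonneg_left h2 hc₁.le
      have h3 := mul_le_mul_of_nonneg_left h3 hc₁.le
      -- At index `0` the rate `c₂` of `B` is split: the part `c₁` is matched with the mode-1
      -- service of `A`, and during the surplus `c₂ - c₁` only `B` loses a job. This determines `g`.
      have h4 := mul_le_mul_of_nonneg_left (hv.one_le_mul_sub h4 h4') (sub_pos.mpr hv.c₁_lt).le
      have h6 : g * (β + l + c₂) ≤ (c₂ - c₁) * (v A' - v (Clock.cloudTwo.step B')) := by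
        refine le_of_mul_le_mul_left ?_ hr
        linarith
      rw [eB1] at eB
      rw [eA2] at eA
      simp only [pow_zero, mul_one] at *
      rw [hA] at *
      have h7 : 0 ≤ c₂ * e A.jobs := mul_nonneg hc₂.le (he _)
      linarith

/-- The constants of the gain estimates. -/
structure GainConstants (lam l c₁ c₂ β g q : ℝ) : Prop where
  q_pos : 0 < q
  q_mul : q * (β + l + c₂) = c₂
  g_pos : 0 < g
  g_mul : (lam + l + c₁ + c₂ + β) * (g * (β + l + c₂)) = c₂ - c₁

variable (hcf : CloudFirst π) (hc : GainConstants lam l c₁ c₂ β g q)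

include hv hcf hc in
-- Both buffers are full in `A`, so it idles, and a local completion in `A` makes the two states
-- equal. At index `0` the matched departures are compared using cloud-first, or
-- `single_cloud_le_local` if the base queue is empty.
theorem gain_mode_one_running (n k : ℕ) :
    g * q ^ k ≤ v ⟨n, true, true, k⟩ - v ⟨n, false, true, k + 1⟩ := by
  refine hv.gain_of_closed hc.q_pos hc.q_mul hc.g_pos hc.g_mul
    (R := fun k B A => ∃ n, B = ⟨n, false, true, k + 1⟩ ∧ A = ⟨n, true, true, k⟩) ?_ ?_
    ⟨n, rfl, rfl⟩
  · rintro k _ _ ⟨n, rfl, rfl⟩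
    simp only [State.jobs, Bool.toNat_true, Bool.toNat_false]
    omega
  · rintro k _ _ ⟨n, rfl, rfl⟩
    refine Or.inr ⟨_, _, le_rfl, rfl, rfl, rfl, π.act_true_true n k, Or.inl ⟨n + 1, rfl, rfl⟩,
      Or.inl ?_, ?_⟩
    · rw [localTwo_true, localTwo_false]
    · cases k with
      | succ m =>
        refine Or.inl ⟨m, rfl, Or.inl ⟨n, ?_⟩, Or.inl ⟨n, ?_⟩⟩
        · rw [cloudOne_succ, cloudOne_succ]; exact ⟨rfl, rfl⟩
        · rw [cloudTwo_succ, cloudTwo_succ]; exact ⟨rfl, rfl⟩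
      | zero =>
        rw [cloudOne_succ, cloudTwo_zero, cloudTwo_succ, cloudOne_true_zero]
        refine Or.inr ⟨rfl, rfl, rfl, Or.inl ⟨n, rfl, rfl⟩, ?_,
          ⟨le_rfl, Nat.zero_le _, le_rfl, le_rfl⟩, ?_⟩
        · cases n with
          | zero => exact hv.single_cloud_le_local hcf
          | succ n => exact (hv.le_sm2 n true 0).trans_eq (hv.eq_cloudFirst hcf n true).symm
        · simp [State.jobs]

include hv hcf hc in
-- If `A` idles, all ticks stay within the relation or merge the states by cloud-first; if `A`
-- starts mode 2, the previous estimate applies.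
theorem gain_base_mode_one (n : ℕ) (i : Bool) (k : ℕ) :
    g * q ^ k ≤ v ⟨n + 1, i, true, k⟩ - v ⟨n, i, true, k + 1⟩ := by
  refine hv.gain_of_closed hc.q_pos hc.q_mul hc.g_pos hc.g_mul
    (R := fun k B A => ∃ n i, B = ⟨n, i, true, k + 1⟩ ∧ A = ⟨n + 1, i, true, k⟩) ?_ ?_
    ⟨n, i, rfl, rfl⟩
  · rintro k _ _ ⟨n, i, rfl, rfl⟩
    simp only [State.jobs]
    omega
  · rintro k _ _ ⟨n, i, rfl, rfl⟩
    have hact : π.act ⟨n + 1, i, true, k⟩ = .idle ∨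
        (i = false ∧ π.act ⟨n + 1, i, true, k⟩ = .sm2) := by
      cases i
      · simpa using π.act_false_true (n + 1) k
      · exact Or.inl (π.act_true_true _ _)
    rcases hact with hact | ⟨rfl, hact⟩
    · refine Or.inr ⟨_, _, le_rfl, rfl, rfl, rfl, hact, Or.inl ⟨n + 1, i, rfl, rfl⟩,
        Or.inr ?_, ?_⟩
      · cases i
        · rw [localTwo_false, localTwo_false]
          exact ⟨k, Or.inl ⟨n, false, rfl, rfl⟩⟩
        · rw [localTwo_true, localTwo_true]
          exact ⟨k + 1, Or.inl ⟨n, false, rfl, rfl⟩⟩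
      · cases k with
        | succ m =>
          refine Or.inl ⟨m, rfl, Or.inl ⟨n, i, ?_⟩, Or.inl ⟨n, i, ?_⟩⟩
          · rw [cloudOne_succ, cloudOne_succ]; exact ⟨rfl, rfl⟩
          · rw [cloudTwo_succ, cloudTwo_succ]; exact ⟨rfl, rfl⟩
        | zero =>
          rw [cloudOne_succ, cloudTwo_zero, cloudTwo_succ, cloudOne_true_zero]
          refine Or.inr ⟨rfl, rfl, rfl, Or.inl ⟨n, i, rfl, rfl⟩,
            (hv.eq_cloudFirst hcf n i).ge, ⟨Nat.le_succ n, le_rfl, le_rfl, le_rfl⟩, ?_⟩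
          simp only [State.jobs]
          omega
    · rw [hv.eq_sm2 hact]
      exact Or.inl (hv.gain_mode_one_running hcf hc n k)

include hv hc in
-- When `A` starts mode 2, `B` does the same, and both buffers of `A` are then full. At index `0`
-- the matched departures lead to the same state, so cloud-first is not needed.
theorem gain_mode_two_for_one (n : ℕ) (i : Bool) (k : ℕ) :
    g * q ^ k ≤ v ⟨n, i, true, k⟩ - v ⟨n, i, false, k + 1⟩ := by
  refine hv.gain_of_closed hc.q_pos hc.q_mul hc.g_pos hc.g_mul
    (R := fun k B A => ∃ n i, B = ⟨n, i, false, k + 1⟩ ∧ A = ⟨n, i, true, k⟩) ?_ ?_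
    ⟨n, i, rfl, rfl⟩
  · rintro k _ _ ⟨n, i, rfl, rfl⟩
    simp only [State.jobs, Bool.toNat_true, Bool.toNat_false]
    omega
  · rintro k _ _ ⟨n, i, rfl, rfl⟩
    right
    have step : ∀ n i, π.act ⟨n, i, true, k⟩ = .idle → ComparisonStep π v
        (fun k B A => (∃ n i, B = ⟨n, i, false, k + 1⟩ ∧ A = ⟨n, i, true, k⟩) ∨
          g * q ^ k ≤ v A - v B) k ⟨n, i, false, k + 1⟩ ⟨n, i, true, k⟩ := by
      intro n i hact
      refine ⟨hact, Or.inl ⟨n + 1, i, rfl, rfl⟩, Or.inr ?_, ?_⟩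
      · cases i
        · rw [localTwo_false, localTwo_false]
          exact ⟨k, Or.inl ⟨n, false, rfl, rfl⟩⟩
        · rw [localTwo_true, localTwo_true]
          exact ⟨k + 1, Or.inl ⟨n, false, rfl, rfl⟩⟩
      · cases k with
        | succ m =>
          refine Or.inl ⟨m, rfl, Or.inl ⟨n, i, ?_⟩, Or.inl ⟨n, i, ?_⟩⟩
          · rw [cloudOne_succ, cloudOne_succ]; exact ⟨rfl, rfl⟩
          · rw [cloudTwo_succ, cloudTwo_succ]; exact ⟨rfl, rfl⟩
        | zero =>
          rw [cloudOne_succ, cloudTwo_zero, cloudTwo_succ, cloudOne_true_zero]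
          refine Or.inr ⟨rfl, rfl, rfl, Or.inl ⟨n, i, rfl, rfl⟩, le_rfl,
            ⟨le_rfl, le_rfl, Nat.zero_le _, le_rfl⟩, ?_⟩
          simp [State.jobs]
    have hact : π.act ⟨n, i, true, k⟩ = .idle ∨
        (i = false ∧ ∃ m, n = m + 1 ∧ π.act ⟨n, i, true, k⟩ = .sm2) := by
      cases i
      · cases n with
        | zero => exact Or.inl (π.act_zero _ _ _)
        | succ n => simpa using π.act_false_true (n + 1) k
      · exact Or.inl (π.act_true_true _ _)
    rcases hact with hact | ⟨rfl, n, rfl, hact⟩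
    · exact ⟨_, _, le_rfl, rfl, rfl, rfl, step n i hact⟩
    · refine ⟨_, _, hv.le_sm2 n false (k + 1), (hv.eq_sm2 hact).symm, ?_, ?_,
        step n true (π.act_true_true n k)⟩ <;>
      simp only [State.jobs, Bool.toNat_true, Bool.toNat_false]

include hv hcf hc in
theorem gain_local_running (n k : ℕ) :
    g * q ^ k ≤ v ⟨n, true, false, k⟩ - v ⟨n, false, false, k + 1⟩ := by
  refine hv.gain_of_closed hc.q_pos hc.q_mul hc.g_pos hc.g_mul
    (R := fun k B A => ∃ n, B = ⟨n, false, false, k + 1⟩ ∧ A = ⟨n, true, false, k⟩) ?_ ?_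
    ⟨n, rfl, rfl⟩
  · rintro k _ _ ⟨n, rfl, rfl⟩
    simp only [State.jobs, Bool.toNat_true, Bool.toNat_false]
    omega
  · rintro k _ _ ⟨n, rfl, rfl⟩
    have hact : (π.act ⟨n, true, false, k⟩ = .idle ∧ (k = 0 → n = 0)) ∨
        ∃ m, n = m + 1 ∧ π.act ⟨n, true, false, k⟩ = .sm1 := by
      cases n with
      | zero => exact Or.inl ⟨π.act_zero _ _ _, fun _ => rfl⟩
      | succ n =>
        cases k with
        | zero => exact Or.inr ⟨n, rfl, hcf _ (Nat.le_add_left 1 n) rfl rfl⟩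
        | succ k => simpa using π.act_true_false (n + 1) (k + 1)
    rcases hact with ⟨hact, hk⟩ | ⟨n, rfl, hact⟩
    · refine Or.inr ⟨_, _, le_rfl, rfl, rfl, rfl, hact, Or.inl ⟨n + 1, rfl, rfl⟩, Or.inl ?_, ?_⟩
      · rw [localTwo_true, localTwo_false]
      · cases k with
        | succ m =>
          refine Or.inl ⟨m, rfl, Or.inl ⟨n, ?_⟩, Or.inl ⟨n, ?_⟩⟩
          · rw [cloudOne_succ, cloudOne_succ]; exact ⟨rfl, rfl⟩
          · rw [cloudTwo_succ, cloudTwo_succ]; exact ⟨rfl, rfl⟩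
        | zero =>
          obtain rfl := hk rfl
          rw [cloudOne_succ, cloudTwo_zero, cloudTwo_succ, cloudOne_false]
          have hsub : State.Sub ⟨0, false, false, 0⟩ ⟨0, true, false, 0⟩ :=
            ⟨le_rfl, Nat.zero_le _, le_rfl, le_rfl⟩
          exact Or.inr ⟨rfl, rfl, rfl, Or.inl ⟨0, rfl, rfl⟩, hv.le_of_sub hsub, hsub,
            by simp [State.jobs]⟩
    · left
      rw [hv.eq_sm1 hact]
      linarith [hv.gain_mode_one_running hcf hc n k, hv.le_sm1 n false (k + 1)]

include hv hcf hc in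
-- The index starts at `1`: with no mode-2 job in `A`, cloud-first sends the base job to mode 1, and
-- the comparison continues with `gain_mode_two_for_one`.
theorem gain_base (n : ℕ) (i : Bool) (k : ℕ) :
    g * q ^ (k + 1) ≤ v ⟨n + 1, i, false, k + 1⟩ - v ⟨n, i, false, k + 2⟩ := by
  refine hv.gain_of_closed hc.q_pos hc.q_mul hc.g_pos hc.g_mul
    (R := fun k B A => ∃ n i m, k = m + 1 ∧ B = ⟨n, i, false, m + 2⟩ ∧
      A = ⟨n + 1, i, false, m + 1⟩) ?_ ?_ ⟨n, i, k, rfl, rfl, rfl⟩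
  · rintro _ _ _ ⟨n, i, k, rfl, rfl, rfl⟩
    simp only [State.jobs]
    omega
  · rintro _ _ _ ⟨n, i, k, rfl, rfl, rfl⟩
    cases hact : π.act ⟨n + 1, i, false, k + 1⟩ with
    | idle =>
      refine Or.inr ⟨_, _, le_rfl, rfl, rfl, rfl, hact, Or.inl ⟨n + 1, i, k, rfl, rfl, rfl⟩,
        Or.inr ?_, Or.inl ⟨k, rfl, Or.inl ⟨n, i, k, rfl, ?_⟩, ?_⟩⟩
      · cases i
        · rw [localTwo_false, localTwo_false]
          exact ⟨k + 1, Or.inl ⟨n, false, k, rfl, rfl, rfl⟩⟩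
        · rw [localTwo_true, localTwo_true]
          exact ⟨k + 2, Or.inl ⟨n, false, k + 1, rfl, rfl, rfl⟩⟩
      · rw [cloudOne_succ, cloudOne_succ]; exact ⟨rfl, rfl⟩
      · rw [cloudTwo_succ, cloudTwo_succ]
        cases k with
        | succ m => exact Or.inl ⟨n, i, m, rfl, rfl, rfl⟩
        | zero =>
          right
          rw [hv.eq_cloudFirst hcf]
          exact hv.gain_mode_two_for_one hc n i 0
    | sm1 =>
      left
      rw [hv.eq_sm1 hact]
      cases n with
      | zero => exact hv.gain_mode_two_for_one hc 0 i (k + 1)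
      | succ n => linarith [hv.gain_base_mode_one hcf hc n i (k + 1), hv.le_sm1 n i (k + 2)]
    | sm2 =>
      left
      obtain rfl : i = false := by
        have := π.admissible ⟨n + 1, i, false, k + 1⟩
        rw [hact] at this
        exact this.2
      rw [hv.eq_sm2 hact]
      exact hv.gain_local_running hcf hc n (k + 1)

end IsOptimalValue

namespace IsOptimalValue

/-! ### The loss from starting a mode-2 service -/

/-- The constants of the loss estimates. -/
structure LossConstants (l c₁ c₂ β g p C c : ℝ) : Prop where
  p_pos : 0 < p
  p_mul : p * (β + l + c₁) = c₁
  C_nonneg : 0 ≤ C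
  c_pos : 0 < c
  c_mul : c * (β + l + c₂) = l * g

/-- The bound of the loss, relative to `q ^ k`. -/
noncomputable def lossBound (C c p : ℝ) (n k : ℕ) : ℝ := max 0 (C * p ^ n - c * k)

variable {lam l c₁ c₂ β : ℝ} {π : Policy} {v : State → ℝ}
  (hv : IsOptimalValue lam l c₁ c₂ β π v) {g q p C c : ℝ}
  (hcf : CloudFirst π) (hg : GainConstants lam l c₁ c₂ β g q)
  (hL : LossConstants l c₁ c₂ β g p C c)

theorem lossBound_nonneg (C c p : ℝ) (n k : ℕ) : 0 ≤ lossBound C c p n k := le_max_left _ _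

include hv hL in
theorem loss_p_le_one : p ≤ 1 := by
  by_contra hlt
  have hs : 0 < β + l + c₁ := by linarith [hv.β_pos, hv.l_pos, hv.c₁_pos]
  have := mul_lt_mul_of_pos_right (not_le.mp hlt) hs
  linarith [hL.p_mul, hv.β_pos, hv.l_pos]

include hv hL in
theorem mul_pow_le_mul_pow {m n : ℕ} (h : m ≤ n) : C * p ^ n ≤ C * p ^ m :=
  mul_le_mul_of_nonneg_left (pow_le_pow_of_le_one hL.p_pos.le (loss_p_le_one hv hL) h)
    hL.C_nonneg

include hv hL in
theorem lossBound_succ_le (n k : ℕ) : lossBound C c p (n + 1) k ≤ lossBound C c p n k :=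
  max_le_max le_rfl (sub_le_sub_right (mul_pow_le_mul_pow hv hL n.le_succ) _)

theorem lossBound_le_succ_add (hc : 0 ≤ c) (n k : ℕ) :
    lossBound C c p n k ≤ lossBound C c p n (k + 1) + c := by
  unfold lossBound
  refine max_le (by positivity) ?_
  have := le_max_right 0 (C * p ^ n - c * ((k + 1 : ℕ) : ℝ))
  push_cast at this ⊢
  linarith

include hv hg hL in
/-- The bound `q ^ k * lossBound` is a supersolution of the recursion of the losses. -/
theorem mul_lossBound_le (n k : ℕ) :
    c₂ * (q ^ k * lossBound C c p n k) - l * (g * q ^ (k + 1))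
      ≤ (β + l + c₂) * (q ^ (k + 1) * lossBound C c p n (k + 1)) := by
  have h1 := lossBound_le_succ_add (C := C) (p := p) hL.c_pos.le n k
  have hs : 0 ≤ (β + l + c₂) * q ^ (k + 1) :=
    mul_nonneg (by linarith [hv.β_pos, hv.l_pos, hv.c₂_pos]) (pow_pos hg.q_pos _).le
  have h2 := mul_le_mul_of_nonneg_left h1 hs
  have h3 : c₂ * q ^ k = (β + l + c₂) * q ^ (k + 1) := by
    rw [pow_succ]
    linear_combination (-q ^ k) * hg.q_mul
  have h4 : c₂ * (q ^ k * lossBound C c p n k)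
      = (β + l + c₂) * q ^ (k + 1) * lossBound C c p n k := by rw [← h3]; ring
  have h5 : l * (g * q ^ (k + 1)) = (β + l + c₂) * q ^ (k + 1) * c := by
    linear_combination (-q ^ (k + 1)) * hL.c_mul
  rw [h4, h5]
  linarith

include hv hcf hg in
-- The states before and after `SM2` are compared up to the next tick. Only the state after `SM2`
-- has a local completion, which earns the gain from `gain_base_mode_one`.
theorem loss_succ_le (n k : ℕ) (h : π.act ⟨n + 1, false, true, k + 1⟩ = .idle) :
    (lam + l + c₁ + c₂ + β) * (v ⟨n, true, true, k + 1⟩ - v ⟨n + 1, false, true, k + 1⟩) ≤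
      lam * (v ⟨n + 1, true, true, k + 1⟩ - v ⟨n + 2, false, true, k + 1⟩) -
      l * (g * q ^ (k + 1)) +
      c₁ * (v ⟨n, true, true, k + 1⟩ - v ⟨n + 1, false, true, k + 1⟩) +
      c₂ * (v ⟨n, true, true, k⟩ - v ⟨n + 1, false, true, k⟩) := by
  have hB := hv.le_backup ⟨n, true, true, k + 1⟩
  have hA := hv.idle_eq _ h
  simp only [arrive_mk, localTwo_true, localTwo_false, cloudOne_succ, cloudTwo_succ, State.jobs,
    Bool.toNat_true, Bool.toNat_false] at hA hB
  have := mul_le_mul_of_nonneg_left (hv.gain_base_mode_one hcf hg n false (k + 1)) hv.l_pos.le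
  push_cast at hA hB
  linarith

include hv hcf hg in
-- Here the mode-1 job is in service. After its departure the idling state immediately restarts mode
-- 1, by cloud-first.
theorem loss_zero_le (n : ℕ) (h : π.act ⟨n + 1, false, true, 0⟩ = .idle) :
    (lam + l + c₁ + c₂ + β) * (v ⟨n, true, true, 0⟩ - v ⟨n + 1, false, true, 0⟩) ≤
      lam * (v ⟨n + 1, true, true, 0⟩ - v ⟨n + 2, false, true, 0⟩) - l * g +
      c₁ * (v ⟨n, true, false, 0⟩ - v ⟨n, false, true, 0⟩) +
      c₂ * (v ⟨n, true, true, 0⟩ - v ⟨n + 1, false, true, 0⟩) := by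
  have hB := hv.le_backup ⟨n, true, true, 0⟩
  have hA := hv.idle_eq _ h
  simp only [arrive_mk, localTwo_true, localTwo_false, cloudOne_true_zero, cloudTwo_zero,
    State.jobs, Bool.toNat_true, Bool.toNat_false] at hA hB
  rw [hv.eq_cloudFirst hcf] at hA
  have := mul_le_mul_of_nonneg_left (hv.gain_base_mode_one hcf hg n false 0) hv.l_pos.le
  rw [pow_zero, mul_one] at this
  push_cast at hA hB
  linarith

include hv in
theorem loss_le_linear : ∃ a b : ℝ, 0 ≤ a ∧ 0 ≤ b ∧ ∀ s s', v s - v s' ≤ a * s.jobs + b := by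
  obtain ⟨a, b, ha, hb, h⟩ := hv.le_linear
  exact ⟨a, b, ha, hb, fun s s' => by linarith [h s, hv.nonneg s']⟩

include hv hcf hg hL in
-- The bound is a supersolution of the recursion for the loss. The factor `p ^ n` counts the mode-1
-- departures at `k = 0` before the base queue empties, where the loss is at most `C`; each step up
-- in `k` subtracts `c`, the relative contribution of one local completion.
theorem loss_le (hC : v ⟨0, true, false, 0⟩ - v ⟨0, false, true, 0⟩ ≤ C) (n k : ℕ) :
    v ⟨n, true, true, k⟩ - v ⟨n + 1, false, true, k⟩ ≤ q ^ k * lossBound C c p n k := by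
  have hlam := hv.lam_pos
  have hl := hv.l_pos
  have hc₁ := hv.c₁_pos
  have hc₂ := hv.c₂_pos
  have hβ := hv.β_pos
  have hq := hg.q_pos
  have hU : ∀ n k, 0 ≤ q ^ k * lossBound C c p n k := fun n k =>
    mul_nonneg (pow_pos hq k).le (lossBound_nonneg ..)
  obtain ⟨a, b, ha, hb, hab⟩ := hv.loss_le_linear
  have key := hv.maximum_principle (ι := ℕ × ℕ) (R := fun _ => True)
    (d := fun i => v ⟨i.1, true, true, i.2⟩ - v ⟨i.1 + 1, false, true, i.2⟩ -
      q ^ i.2 * lossBound C c p i.1 i.2) (N := fun i => i.1 + 1 + 1 + i.2) ha hb ?_ ?_ (n, k)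
    trivial
  · dsimp only at key
    linarith
  · rintro ⟨n, k⟩ -
    have h1 := hab ⟨n, true, true, k⟩ ⟨n + 1, false, true, k⟩
    have h2 := hU n k
    simp only [State.jobs, Bool.toNat_true] at h1
    dsimp only
    linarith
  · rintro e he hmono hd ⟨n, k⟩ -
    rcases π.act_false_true (n + 1) k with hact | hact
    swap
    · left
      dsimp only
      rw [hv.eq_sm2 hact, sub_self, zero_sub]
      linarith [hU n k]
    right
    dsimp only
    have hd : ∀ n k, v ⟨n, true, true, k⟩ - v ⟨n + 1, false, true, k⟩ ≤
        q ^ k * lossBound C c p n k + e (n + 1 + 1 + k) := fun n k => by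
      have := hd (n, k) trivial
      dsimp only at this
      linarith
    have hU1 : q ^ k * lossBound C c p (n + 1) k ≤ q ^ k * lossBound C c p n k :=
      mul_le_mul_of_nonneg_left (lossBound_succ_le hv hL n k) (pow_pos hq k).le
    have h0 := (hd (n + 1) k).trans (add_le_add_left hU1 _)
    rw [show n + 1 + 1 + 1 + k = n + 1 + 1 + k + 1 by omega] at h0
    have h0 := mul_le_mul_of_nonneg_left h0 hlam.le
    have he' : 0 ≤ l * e (n + 1 + 1 + k) := mul_nonneg hl.le (he _)
    cases k with
    | succ k =>
      have h1 := hv.loss_succ_le hcf hg n k hact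
      have h2 := mul_le_mul_of_nonneg_left (hd n (k + 1)) hc₁.le
      have h3 := mul_le_mul_of_nonneg_left ((hd n k).trans (add_le_add_right
        (hmono (show n + 1 + 1 + k ≤ n + 1 + 1 + (k + 1) by omega)) _)) hc₂.le
      have h4 := mul_lossBound_le hv hg hL n k
      linarith
    | zero =>
      have h1 := hv.loss_zero_le hcf hg n hact
      have h2 := mul_le_mul_of_nonneg_left (hd n 0) hc₂.le
      have hU0 : ∀ n, q ^ 0 * lossBound C c p n 0 = C * p ^ n := fun n => by
        rw [pow_zero, one_mul, lossBound, Nat.cast_zero, mul_zero, sub_zero,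
          max_eq_right (mul_nonneg hL.C_nonneg (pow_pos hL.p_pos n).le)]
      have h3 : c₁ * (v ⟨n, true, false, 0⟩ - v ⟨n, false, true, 0⟩) ≤
          (β + l + c₁) * (C * p ^ n) + c₁ * e (n + 1 + 1 + 0) := by
        cases n with
        | zero =>
          have h5 := mul_le_mul_of_nonneg_left hC hc₁.le
          have h6 : 0 ≤ c₁ * e (0 + 1 + 1 + 0) := mul_nonneg hc₁.le (he _)
          have h7 : 0 ≤ (β + l) * C := mul_nonneg (by positivity) hL.C_nonneg
          rw [pow_zero, mul_one]
          linarith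
        | succ n =>
          rw [hv.eq_cloudFirst hcf]
          have h5 := mul_le_mul_of_nonneg_left ((hd n 0).trans (add_le_add_right
            (hmono (show n + 1 + 1 + 0 ≤ n + 1 + 1 + 1 + 0 by omega)) _)) hc₁.le
          rw [hU0] at h5
          have h6 : (β + l + c₁) * (C * p ^ (n + 1)) = c₁ * (C * p ^ n) := by
            rw [pow_succ]
            linear_combination (C * p ^ n) * hL.p_mul
          linarith
      rw [hU0] at *
      have : 0 < l * g := mul_pos hl hg.g_pos
      linarith

include hv hcf hg hL in
-- Under the hypothesis the bound vanishes at `k + 1`, so the loss there is exactly `0`, while at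
-- `k` it is below `c` relative to `q ^ k`. Idling would then force `0` below a negative number.
theorem act_sm2_of_succ (hC : v ⟨0, true, false, 0⟩ - v ⟨0, false, true, 0⟩ ≤ C) {n k : ℕ}
    (h : C * p ^ n < c * (k + 1)) : π.act ⟨n + 1, false, true, k + 1⟩ = .sm2 := by
  refine (π.act_false_true _ _).resolve_left fun hact => ?_
  have hs : 0 < β + l + c₂ := by linarith [hv.β_pos, hv.l_pos, hv.c₂_pos]
  have hzero : lossBound C c p n (k + 1) = 0 := max_eq_left (by push_cast; linarith)
  have hzero' : lossBound C c p (n + 1) (k + 1) = 0 :=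
    le_antisymm (hzero ▸ lossBound_succ_le hv hL n (k + 1)) (lossBound_nonneg ..)
  have hlt : lossBound C c p n k < c := max_lt hL.c_pos (by linarith)
  have h0 := hv.le_sm2 n true (k + 1)
  have h1 := hv.loss_succ_le hcf hg n k hact
  have d0 := hv.loss_le hcf hg hL hC (n + 1) (k + 1)
  have d1 := hv.loss_le hcf hg hL hC n (k + 1)
  have d2 := hv.loss_le hcf hg hL hC n k
  rw [hzero', mul_zero] at d0
  rw [hzero, mul_zero] at d1
  have e1 : v ⟨n, true, true, k + 1⟩ - v ⟨n + 1, false, true, k + 1⟩ = 0 :=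
    le_antisymm d1 (sub_nonneg.mpr h0)
  have e0 := mul_le_mul_of_nonneg_left d0 hv.lam_pos.le
  have e2 := mul_le_mul_of_nonneg_left d2 hv.c₂_pos.le
  rw [e1, mul_zero, mul_zero] at h1
  have h3 : c₂ * q ^ k * lossBound C c p n k < c₂ * q ^ k * c :=
    mul_lt_mul_of_pos_left hlt (mul_pos hv.c₂_pos (pow_pos hg.q_pos k))
  have h4 : c₂ * q ^ k * c = l * (g * q ^ (k + 1)) := by
    rw [pow_succ]
    linear_combination (-c * q ^ k) * hg.q_mul + q ^ k * q * hL.c_mul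
  linarith

include hv hcf hg hL in
-- With no mode-2 job at the cloud the bound `C * p ^ n` is positive whenever `C` is, so the
-- argument instead asks that all losses in the recursion together stay below the gain `l * g`.
theorem act_sm2_of_zero (hC : v ⟨0, true, false, 0⟩ - v ⟨0, false, true, 0⟩ ≤ C) {n : ℕ}
    (h : (lam + l + c₁ + c₂ + β) * (C * p ^ n) < l * g) :
    π.act ⟨n + 2, false, true, 0⟩ = .sm2 := by
  refine (π.act_false_true _ _).resolve_left fun hact => ?_
  have hU0 : ∀ n, q ^ 0 * lossBound C c p n 0 = C * p ^ n := fun n => by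
    rw [pow_zero, one_mul, lossBound, Nat.cast_zero, mul_zero, sub_zero,
      max_eq_right (mul_nonneg hL.C_nonneg (pow_pos hL.p_pos n).le)]
  have h0 := hv.le_sm2 (n + 1) true 0
  have h1 := hv.loss_zero_le hcf hg (n + 1) hact
  rw [hv.eq_cloudFirst hcf] at h1
  have d0 := hv.loss_le hcf hg hL hC (n + 2) 0
  have d1 := hv.loss_le hcf hg hL hC (n + 1) 0
  have d2 := hv.loss_le hcf hg hL hC n 0
  rw [hU0] at d0 d1 d2
  have e0 := mul_le_mul_of_nonneg_left (d0.trans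
    (mul_pow_le_mul_pow hv hL (show n ≤ n + 2 by omega))) hv.lam_pos.le
  have e1 := mul_le_mul_of_nonneg_left (d1.trans
    (mul_pow_le_mul_pow hv hL (show n ≤ n + 1 by omega))) hv.c₂_pos.le
  have e2 := mul_le_mul_of_nonneg_left d2 hv.c₁_pos.le
  have hr : 0 ≤ lam + l + c₁ + c₂ + β := by
    linarith [hv.lam_pos, hv.l_pos, hv.c₁_pos, hv.c₂_pos, hv.β_pos]
  have e3 := mul_nonneg hr (sub_nonneg.mpr h0)
  rw [show n + 2 + 1 = n + 1 + 2 by omega] at e0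
  have e4 : 0 ≤ (l + β) * (C * p ^ n) := mul_nonneg (by linarith [hv.l_pos, hv.β_pos])
    (mul_nonneg hL.C_nonneg (pow_pos hL.p_pos n).le)
  linarith

end IsOptimalValue

namespace IsOptimalValue

variable {lam l c₁ c₂ β : ℝ} {π : Policy} {v : State → ℝ}
  (hv : IsOptimalValue lam l c₁ c₂ β π v) {g q p C c : ℝ}
  (hcf : CloudFirst π) (hg : GainConstants lam l c₁ c₂ β g q)
  (hL : LossConstants l c₁ c₂ β g p C c)
  (hC : v ⟨0, true, false, 0⟩ - v ⟨0, false, true, 0⟩ ≤ C)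

/-! ### States without a mode-1 job at the cloud -/

include hv hcf hg in
theorem loss_vacant_le (n k : ℕ) (h : π.act ⟨n + 1, false, false, k + 1⟩ = .idle) :
    (lam + l + c₁ + c₂ + β) * (v ⟨n, true, false, k + 1⟩ - v ⟨n + 1, false, false, k + 1⟩) ≤
      lam * (v ⟨n + 1, true, false, k + 1⟩ - v ⟨n + 2, false, false, k + 1⟩) -
      l * (g * q ^ (k + 1)) +
      c₁ * (v ⟨n, true, false, k + 1⟩ - v ⟨n + 1, false, false, k + 1⟩) +
      c₂ * (v ⟨n, true, false, k⟩ - v ⟨n + 1, false, false, k⟩) := by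
  have hB := hv.le_backup ⟨n, true, false, k + 1⟩
  have hA := hv.idle_eq _ h
  simp only [arrive_mk, localTwo_true, localTwo_false, cloudOne_succ, cloudTwo_succ, State.jobs,
    Bool.toNat_true, Bool.toNat_false] at hA hB
  have := mul_le_mul_of_nonneg_left (hv.gain_base hcf hg n false k) hv.l_pos.le
  push_cast at hA hB
  linarith

include hv hcf hg hL hC in
-- The shift in `n` accounts for the job that cloud-first puts into mode 1: at `k = 0` both states
-- turn into those of `loss_le` with one base job fewer.
theorem loss_vacant_bound (n k : ℕ) :
    v ⟨n + 1, true, false, k⟩ - v ⟨n + 2, false, false, k⟩ ≤ q ^ k * lossBound C c p n k := by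
  have hlam := hv.lam_pos
  have hl := hv.l_pos
  have hc₁ := hv.c₁_pos
  have hc₂ := hv.c₂_pos
  have hq := hg.q_pos
  have hU : ∀ n k, 0 ≤ q ^ k * lossBound C c p n k := fun n k =>
    mul_nonneg (pow_pos hq k).le (lossBound_nonneg ..)
  obtain ⟨a, b, ha, hb, hab⟩ := hv.loss_le_linear
  have key := hv.maximum_principle (ι := ℕ × ℕ) (R := fun _ => True)
    (d := fun i => v ⟨i.1 + 1, true, false, i.2⟩ - v ⟨i.1 + 2, false, false, i.2⟩ -
      q ^ i.2 * lossBound C c p i.1 i.2) (N := fun i => i.1 + 2 + i.2) ha hb ?_ ?_ (n, k)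
    trivial
  · dsimp only at key
    linarith
  · rintro ⟨n, k⟩ -
    have h1 := hab ⟨n + 1, true, false, k⟩ ⟨n + 2, false, false, k⟩
    have h2 := hU n k
    simp only [State.jobs, Bool.toNat_true, Bool.toNat_false, add_zero] at h1
    dsimp only
    linarith
  · rintro e he hmono hd ⟨n, k⟩ -
    dsimp only
    cases k with
    | zero =>
      left
      rw [hv.eq_cloudFirst hcf, hv.eq_cloudFirst hcf]
      linarith [hv.loss_le hcf hg hL hC n 0]
    | succ k =>
    cases hact : π.act ⟨n + 2, false, false, k + 1⟩ with
    | sm1 =>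
      left
      rw [hv.eq_sm1 hact]
      linarith [hv.loss_le hcf hg hL hC n (k + 1), hv.le_sm1 n true (k + 1)]
    | sm2 =>
      left
      rw [hv.eq_sm2 hact, sub_self, zero_sub]
      linarith [hU n (k + 1)]
    | idle =>
      right
      have hd : ∀ n k, v ⟨n + 1, true, false, k⟩ - v ⟨n + 2, false, false, k⟩ ≤
          q ^ k * lossBound C c p n k + e (n + 2 + k) := fun n k => by
        have := hd (n, k) trivial
        dsimp only at this
        linarith
      have hU1 : q ^ (k + 1) * lossBound C c p (n + 1) (k + 1) ≤
          q ^ (k + 1) * lossBound C c p n (k + 1) :=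
        mul_le_mul_of_nonneg_left (lossBound_succ_le hv hL n _) (pow_pos hq _).le
      have h0 := (hd (n + 1) (k + 1)).trans (add_le_add_left hU1 _)
      rw [show n + 1 + 2 + (k + 1) = n + 2 + (k + 1) + 1 by omega] at h0
      have h0 := mul_le_mul_of_nonneg_left h0 hlam.le
      have he' : 0 ≤ l * e (n + 2 + (k + 1)) := mul_nonneg hl.le (he _)
      have h1 := hv.loss_vacant_le hcf hg (n + 1) k hact
      have h2 := mul_le_mul_of_nonneg_left (hd n (k + 1)) hc₁.le
      have h3 := mul_le_mul_of_nonneg_left ((hd n k).trans (add_le_add_right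
        (hmono (show n + 2 + k ≤ n + 2 + (k + 1) by omega)) _)) hc₂.le
      have h4 := mul_lossBound_le hv hg hL n k
      linarith

include hv hcf hg hL hC in
theorem act_vacant_ne_idle {n k : ℕ} (h : C * p ^ n < c * (k + 1)) :
    π.act ⟨n + 2, false, false, k + 1⟩ ≠ .idle := by
  intro hact
  have hzero : lossBound C c p n (k + 1) = 0 := max_eq_left (by push_cast; linarith)
  have hzero' : lossBound C c p (n + 1) (k + 1) = 0 :=
    le_antisymm (hzero ▸ lossBound_succ_le hv hL n (k + 1)) (lossBound_nonneg ..)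
  have hlt : lossBound C c p n k < c := max_lt hL.c_pos (by linarith)
  have h0 := hv.le_sm2 (n + 1) false (k + 1)
  have h1 := hv.loss_vacant_le hcf hg (n + 1) k hact
  have d0 := hv.loss_vacant_bound hcf hg hL hC (n + 1) (k + 1)
  have d1 := hv.loss_vacant_bound hcf hg hL hC n (k + 1)
  have d2 := hv.loss_vacant_bound hcf hg hL hC n k
  rw [hzero', mul_zero] at d0
  rw [hzero, mul_zero] at d1
  have e1 : v ⟨n + 1, true, false, k + 1⟩ - v ⟨n + 1 + 1, false, false, k + 1⟩ = 0 :=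
    le_antisymm d1 (sub_nonneg.mpr h0)
  have e0 := mul_le_mul_of_nonneg_left d0 hv.lam_pos.le
  have e2 := mul_le_mul_of_nonneg_left d2 hv.c₂_pos.le
  rw [e1, mul_zero, mul_zero] at h1
  have h3 : c₂ * q ^ k * lossBound C c p n k < c₂ * q ^ k * c :=
    mul_lt_mul_of_pos_left hlt (mul_pos hv.c₂_pos (pow_pos hg.q_pos k))
  have h4 : c₂ * q ^ k * c = l * (g * q ^ (k + 1)) := by
    rw [pow_succ]
    linear_combination (-c * q ^ k) * hg.q_mul + q ^ k * q * hL.c_mul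
  linarith

/-! ### Mode 1 is strictly suboptimal while the cloud serves mode-2 jobs -/

include hv hcf hg hL hC in
-- The hypothesis ensures that after an arrival the mode-1 state starts mode 2. Both states can then
-- reach the same configuration, so the arrival term is nonpositive.
theorem single_loss_succ_le {k : ℕ} (h : C < c * (k + 1)) :
    (lam + β + l + c₂) * (v ⟨0, true, false, k + 1⟩ - v ⟨0, false, true, k + 1⟩) ≤
      c₂ * (v ⟨0, true, false, k⟩ - v ⟨0, false, true, k⟩) - l * (g * q ^ (k + 1)) := by
  have hB := hv.le_backup ⟨0, true, false, k + 1⟩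
  have hA := hv.idle_eq _ (π.act_zero false true (k + 1))
  simp only [arrive_mk, localTwo_true, localTwo_false, cloudOne_succ, cloudTwo_succ, State.jobs,
    Bool.toNat_true, Bool.toNat_false] at hA hB
  have e0 := mul_le_mul_of_nonneg_left (hv.gain_mode_two_for_one hg 0 false (k + 1)) hv.l_pos.le
  have e1 := hv.eq_sm2 (hv.act_sm2_of_succ hcf hg hL hC (n := 0) (k := k) (by simpa using h))
  have e2 := mul_le_mul_of_nonneg_left ((hv.le_sm1 0 true (k + 1)).trans_eq e1.symm) hv.lam_pos.le
  push_cast at hA hB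
  linarith

include hv hcf hg hL hC in
-- While the difference is positive, divided by `q ^ k` it falls by at least `c` per step, so it
-- cannot stay positive; once it is nonpositive, the gain term makes it strictly negative forever.
theorem exists_single_loss_neg : ∃ k₀ : ℕ, C < c * (k₀ + 1) ∧ ∀ k, k₀ ≤ k →
    v ⟨0, true, false, k + 1⟩ < v ⟨0, false, true, k + 1⟩ := by
  have hlam := hv.lam_pos
  have hl := hv.l_pos
  have hc₂ := hv.c₂_pos
  have hβ := hv.β_pos
  have hq := hg.q_pos
  have hgp := hg.g_pos
  have hcp := hL.c_pos
  obtain ⟨k₁, hk₁⟩ := exists_nat_gt (C / c)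
  have hK : ∀ k, k₁ ≤ k → C < c * (k + 1) := by
    intro k hk
    have h1 : (k₁ : ℝ) ≤ k := by exact_mod_cast hk
    have h2 := mul_le_mul_of_nonneg_left h1 hcp.le
    rw [div_lt_iff₀ hcp] at hk₁
    linarith
  have hneg : ∃ k₂, k₁ ≤ k₂ ∧ v ⟨0, true, false, k₂⟩ ≤ v ⟨0, false, true, k₂⟩ := by
    by_contra! hpos
    -- `X` is the normalized difference at `k₁`, from which the linear decrease starts.
    let X := (v ⟨0, true, false, k₁⟩ - v ⟨0, false, true, k₁⟩) / q ^ k₁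
    have hX : ∀ j : ℕ, v ⟨0, true, false, k₁ + j⟩ - v ⟨0, false, true, k₁ + j⟩ ≤
        q ^ (k₁ + j) * (X - c * j) := by
      intro j
      induction j with
      | zero =>
        simp only [Nat.cast_zero, mul_zero, sub_zero, add_zero, X]
        rw [mul_div_cancel₀ _ (pow_pos hq _).ne']
      | succ j ih =>
        have h1 := hv.single_loss_succ_le hcf hg hL hC (hK (k₁ + j) (by omega))
        have h2 := mul_nonneg hlam.le (sub_pos.mpr (hpos (k₁ + (j + 1)) (by omega))).le
        have h3 := mul_le_mul_of_nonneg_left ih hc₂.le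
        have h4 : c₂ * (q ^ (k₁ + j) * (X - c * j)) - l * (g * q ^ (k₁ + j + 1)) =
            (β + l + c₂) * (q ^ (k₁ + j + 1) * (X - c * (j + 1))) := by
          rw [pow_succ]
          linear_combination (-(q ^ (k₁ + j)) * (X - c * j)) * hg.q_mul +
            (q ^ (k₁ + j) * q) * hL.c_mul
        refine le_of_mul_le_mul_left ?_ (show 0 < β + l + c₂ by positivity)
        push_cast
        rw [← add_assoc] at h2 ⊢
        linarith
    obtain ⟨j, hj⟩ := exists_nat_gt (X / c)
    rw [div_lt_iff₀ hcp] at hj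
    have h1 := hX j
    have h2 := hpos (k₁ + j) (by omega)
    have h3 : q ^ (k₁ + j) * (X - c * j) < 0 :=
      mul_neg_of_pos_of_neg (pow_pos hq _) (by linarith)
    linarith
  obtain ⟨k₂, hk₂, hle⟩ := hneg
  have hs : 0 < lam + β + l + c₂ := by positivity
  have step : ∀ k, k₂ ≤ k → v ⟨0, true, false, k⟩ ≤ v ⟨0, false, true, k⟩ →
      v ⟨0, true, false, k + 1⟩ < v ⟨0, false, true, k + 1⟩ := by
    intro k hk h
    have h1 := hv.single_loss_succ_le hcf hg hL hC (hK k (by omega))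
    have h2 := mul_nonneg hc₂.le (sub_nonneg.mpr h)
    have h3 : 0 < l * (g * q ^ (k + 1)) := by positivity
    have h4 := pos_of_mul_pos_right (a := lam + β + l + c₂)
      (b := v ⟨0, false, true, k + 1⟩ - v ⟨0, true, false, k + 1⟩) (by linarith) hs.le
    linarith
  refine ⟨k₂, hK k₂ hk₂, fun k hk => ?_⟩
  induction k, hk using Nat.le_induction with
  | base => exact step k₂ le_rfl hle
  | succ k hk ih => exact step (k + 1) (by omega) ih.le

include hv in
-- Strictness comes solely from the local completion, which raises `n₂` by one; the other ticks
-- contribute weak inequalities.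
theorem sm1_lt_of_local {n k : ℕ} (h : v ⟨n + 1, false, false, k + 2⟩ < v ⟨n, false, true, k + 2⟩) :
    v ⟨n + 1, true, false, k + 1⟩ < v ⟨n, true, true, k + 1⟩ := by
  have hB := hv.le_backup ⟨n + 1, true, false, k + 1⟩
  have hA := hv.idle_eq _ (π.act_true_true n (k + 1))
  simp only [arrive_mk, localTwo_true, cloudOne_succ, cloudTwo_succ, State.jobs, Bool.toNat_true,
    Bool.toNat_false] at hA hB
  have e0 := mul_le_mul_of_nonneg_left (hv.le_sm1 (n + 1) true (k + 1)) hv.lam_pos.le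
  have e1 := mul_lt_mul_of_pos_left h hv.l_pos
  have e2 := mul_le_mul_of_nonneg_left (hv.le_sm1 n true k) hv.c₂_pos.le
  have hs : 0 < lam + l + c₂ + β := by linarith [hv.lam_pos, hv.l_pos, hv.c₂_pos, hv.β_pos]
  push_cast at hA hB
  refine lt_of_mul_lt_mul_left ?_ hs.le
  linarith

include hv in
theorem sm1_lt_of_sm2 {n k : ℕ} (h : v ⟨n + 1, true, false, k⟩ < v ⟨n, true, true, k⟩)
    (hact : π.act ⟨n + 1, false, true, k⟩ = .sm2) :
    v ⟨n + 2, false, false, k⟩ < v ⟨n + 1, false, true, k⟩ := by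
  rw [hv.eq_sm2 hact]
  exact (hv.le_sm2 (n + 1) false k).trans_lt h

include hv hcf hg hL hC in
-- Combining `sm1_lt_of_local` with `sm1_lt_of_sm2` trades one unit of `n₂` for one base job.
-- Starting from the range of large `n₂`, at most `k₀` trades reach every positive `n₂`, so `M = N +
-- k₀` suffices.
theorem exists_sm1_lt {N : ℕ}
    (hN : ∀ n k, N ≤ n → π.act ⟨n + 1, false, true, k⟩ = .sm2) :
    ∃ M, ∀ n k, M ≤ n → v ⟨n + 1, false, false, k + 1⟩ < v ⟨n, false, true, k + 1⟩ := by
  obtain ⟨k₀, hk₀, hneg⟩ := hv.exists_single_loss_neg hcf hg hL hC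
  have large : ∀ n k, k₀ ≤ k →
      v ⟨n + 1, false, false, k + 1⟩ < v ⟨n, false, true, k + 1⟩ := by
    intro n
    induction n with
    | zero => exact fun k hk => (hv.le_sm2 0 false (k + 1)).trans_lt (hneg k hk)
    | succ n ih =>
      intro k hk
      refine hv.sm1_lt_of_sm2 (hv.sm1_lt_of_local (ih (k + 1) (by omega)))
        (hv.act_sm2_of_succ hcf hg hL hC ?_)
      have h1 : C * p ^ n ≤ C * p ^ 0 := mul_pow_le_mul_pow hv hL (Nat.zero_le n)
      have h2 : (k₀ : ℝ) ≤ k := by exact_mod_cast hk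
      have h3 := mul_le_mul_of_nonneg_left h2 hL.c_pos.le
      rw [pow_zero, mul_one] at h1
      linarith
  have down : ∀ j n k, k₀ ≤ k + j → N + j ≤ n →
      v ⟨n + 1, false, false, k + 1⟩ < v ⟨n, false, true, k + 1⟩ := by
    intro j
    induction j with
    | zero => exact fun n k hk _ => large n k hk
    | succ j ih =>
      intro n k hk hn
      obtain ⟨n, rfl⟩ := Nat.exists_eq_succ_of_ne_zero (show n ≠ 0 by omega)
      exact hv.sm1_lt_of_sm2 (hv.sm1_lt_of_local (ih n (k + 1) (by omega) (by omega)))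
        (hN n _ (by omega))
  exact ⟨N + k₀, fun n k hn => down k₀ n k (by omega) hn⟩

/-! ### The uniform threshold -/

include hv hcf in
/-- Beyond a threshold of the base queue, mode 2 is chosen whenever the local server is free and
the cloud is occupied. -/
theorem exists_threshold : ∃ N, ∀ n k, N ≤ n → π.act ⟨n, false, true, k⟩ = .sm2 ∧
    π.act ⟨n, false, false, k + 1⟩ = .sm2 := by
  have hlam := hv.lam_pos
  have hl := hv.l_pos
  have hc₁ := hv.c₁_pos
  have hc₂ := hv.c₂_pos
  have hβ := hv.β_pos
  have hc₁₂ := sub_pos.mpr hv.c₁_lt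
  have hg : GainConstants lam l c₁ c₂ β
      ((c₂ - c₁) / ((lam + l + c₁ + c₂ + β) * (β + l + c₂))) (c₂ / (β + l + c₂)) :=
    ⟨by positivity, by field_simp, by positivity, by field_simp⟩
  generalize (c₂ - c₁) / ((lam + l + c₁ + c₂ + β) * (β + l + c₂)) = g at hg
  have hgp := hg.g_pos
  have hL : LossConstants l c₁ c₂ β g (c₁ / (β + l + c₁))
      (max 0 (v ⟨0, true, false, 0⟩ - v ⟨0, false, true, 0⟩)) (l * g / (β + l + c₂)) :=
    ⟨by positivity, by field_simp, le_max_left _ _, by positivity, by field_simp⟩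
  have hC := le_max_right 0 (v ⟨0, true, false, 0⟩ - v ⟨0, false, true, 0⟩)
  have hp1 : c₁ / (β + l + c₁) < 1 := (div_lt_one (by positivity)).mpr (by linarith)
  generalize max 0 (v ⟨0, true, false, 0⟩ - v ⟨0, false, true, 0⟩) = C at hL hC
  generalize l * g / (β + l + c₂) = c at hL
  generalize c₁ / (β + l + c₁) = p at hL hp1
  have hcp := hL.c_pos
  have hr : 0 < lam + l + c₁ + c₂ + β := by positivity
  have hlim : Filter.Tendsto (fun n : ℕ => C * p ^ n) Filter.atTop (nhds (C * 0)) :=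
    (tendsto_pow_atTop_nhds_zero_of_lt_one hL.p_pos.le hp1).const_mul C
  rw [mul_zero] at hlim
  obtain ⟨m, hm⟩ := Filter.eventually_atTop.mp
    -- The two entries of the minimum serve the cases `1 ≤ n₂` and `n₂ = 0` respectively.
    (hlim.eventually_lt_const (show 0 < min c (l * g / (lam + l + c₁ + c₂ + β)) by positivity))
  have hsmall : ∀ n (k : ℕ), m ≤ n → C * p ^ n < c * (k + 1) := by
    intro n k hn
    have h1 := (hm n hn).trans_le (min_le_left _ _)
    have h2 : 0 ≤ c * (k : ℝ) := by positivity
    linarith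
  have hN : ∀ n k, m + 1 ≤ n → π.act ⟨n + 1, false, true, k⟩ = .sm2 := by
    intro n k hn
    obtain ⟨n, rfl⟩ := Nat.exists_eq_succ_of_ne_zero (show n ≠ 0 by omega)
    cases k with
    | zero =>
      refine hv.act_sm2_of_zero hcf hg hL hC ?_
      have h1 := (hm n (by omega)).trans_le (min_le_right _ _)
      rwa [lt_div_iff₀' hr] at h1
    | succ k => exact hv.act_sm2_of_succ hcf hg hL hC (hsmall _ k (by omega))
  obtain ⟨M, hM⟩ := hv.exists_sm1_lt hcf hg hL hC hN
  refine ⟨m + M + 2, fun n k hn => ?_⟩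
  obtain ⟨n, rfl⟩ := Nat.exists_eq_add_of_le' (show 2 ≤ n by omega)
  refine ⟨hN (n + 1) k (by omega), ?_⟩
  cases hact : π.act ⟨n + 2, false, false, k + 1⟩ with
  | idle => exact absurd hact (hv.act_vacant_ne_idle hcf hg hL hC (hsmall n k (by omega)))
  | sm1 => exact absurd (hv.eq_sm1 hact) (hM (n + 1) k (by omega)).ne
  | sm2 => rfl

end IsOptimalValue

end Offload

theorem mainTheorem3 (P : Offload.Params) (π : Offload.Policy)
    (hopt : Offload.DelayOptimal P π) (hcf : Offload.CloudFirst π) :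
    ∃ N N' : ℕ → ℕ, Antitone N ∧ AntitoneOn N' (Set.Ici 1) ∧
      (∀ k x₀ x₂ : ℕ, π.act ⟨N k + x₀, false, true, k + x₂⟩ = Offload.Action.sm2) ∧
      (∀ k : ℕ, 1 ≤ k → ∀ x₀ x₂ : ℕ,
        π.act ⟨N' k + x₀, false, false, k + x₂⟩ = Offload.Action.sm2) := by
  obtain ⟨N, hN⟩ := hopt.isOptimalValue.exists_threshold hcf
  refine ⟨fun _ => N, fun _ => N, antitone_const, antitone_const.antitoneOn _,
    fun k x₀ x₂ => (hN _ _ (Nat.le_add_right _ _)).1, fun k hk x₀ x₂ => ?_⟩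
  -- The vacant case of the threshold is indexed by `n₂ - 1`, which is why `1 ≤ k` is needed.
  have := (hN (N + x₀) (k - 1 + x₂) (Nat.le_add_right _ _)).2
  rwa [show k - 1 + x₂ + 1 = k + x₂ by omega] at this
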